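/- Let $n\ge 1$, let $p_1,\dots,p_{2n}\in(0,1)$ satisfy $p_{2n-i+1}=p_i$ for $1\le i\le n$, and let $\alpha,\beta\ge 0$ with $\alpha p_i<1$ for $1\le i\le n$. Let $(W_{i,j})_{1\le i,j\le 2n}$ be a random array of non-negative integers that is symmetric about the antidiagonal and the diagonal, i.e. $W_{i,j}=W_{2n-j+1,\,2n-i+1}=W_{j,i}$ for all $i,j$, such that the weights $W_{i,j}$ with $1\le i\le j\le 2n-i+1$ are independent with, for all $k\in\mathbb{Z}_{\ge 0}$, $$\mathbb{P}(W_{i,j}=k)=\begin{cases}(1-p_ip_j)(p_ip_j)^k & \text{if } i<j<2n-i+1,\\[2pt] \dfrac{1-p_j^2}{1+\beta p_j}\,\beta^{k \bmod 2}\,p_j^k & \text{if } i<j=2n-i+1,\\[2pt] (1-\alpha p_j)(\alpha p_j)^k & \text{if } 1\le i=j\le n\end{cases}$$ (with the convention $0^0=1$). Let $$L=\max_{\pi}\sum_{(i,j)\in\pi}W_{i,j},$$ where the maximum is over all directed paths $\pi$ from $(1,1)$ to $(2n,2n)$, i.e. finite sequences of points with steps $(1,0)$ or $(0,1)$. Set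 $$c=\prod_{1\le i<j\le n}\frac{1}{(1-p_ip_j)^2}\ \prod_{j=1}^n\frac{1+\beta p_j}{1-p_j^2}\cdot\frac{1}{1-\alpha p_j}.$$ An $n$-partition (respectively $n$-half-partition) is a vector $\lambda_1\ge\dots\ge\lambda_n\ge 0$ whose parts are all integers (respectively all half-integers, i.e. elements of $\tfrac12+\mathbb{Z}$). A split orthogonal pattern of height $2n$ and shape $\lambda$ is an array $z=(z_{i,j})_{1\le i\le 2n,\,1\le j\le\lceil i/2\rceil}$ with $z_{2n,j}=\lambda_j$ for $1\le j\le n$ such that: the odd ends $z_{2i-1,i}$, $1\le i\le n$, are in $\tfrac12\mathbb{Z}_{\ge0}$; the other entries are either all in $\mathbb{Z}_{\ge0}$ or all in $\tfrac12+\mathbb{Z}_{\ge0}$; and $z_{i+1,j+1}\le z_{i,j}\le z_{i+1,j}$ whenever the entries involved exist. If $z_{2n,1}$ is an integer (respectively a half-integer), an entry of $z$ is called atypical if it is a half-integer (respectively an integer); $a(z)$ is the number of atypical entries. With $\mathrm{type}(z)_i=\sum_j z_{i,j}-\sum_j z_{i-1,j}$ (where row $0$ is empty), define for $x=(x_1,\dots,x_n)$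 the $\mathrm{CB}$-interpolating Schur polynomial $$\mathrm{trans}_\lambda(x;\beta)=\sum_{z}\beta^{a(z)}\prod_{i=1}^n x_i^{\mathrm{type}(z)_{2i}-\mathrm{type}(z)_{2i-1}},$$ where the sum is over all split orthogonal patterns $z$ of height $2n$ and shape $\lambda$. Then for all $u\in\frac12\mathbb{Z}_{\ge 0}$, $$c\cdot\mathbb{P}(L\le 2u)=\Big[\prod_{i=1}^n p_i\Big]^u\sum_{\lambda\subseteq u^{(n)}}\alpha^{\sum_{i=1}^n(-1)^{n-i}(u-\lambda_i)}\ \mathrm{trans}_\lambda(p_1,\dots,p_n;\beta),$$ where the sum is over all $n$-partitions $\lambda$ (if $u$ is an integer), respectively all $n$-half-partitions $\lambda$ (if $u$ is a half-integer), with $\lambda_i\le u$ for $1\le i\le n$. -/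

import Mathlib

open MeasureTheory ProbabilityTheory

noncomputable section

namespace SymLPP

/-! ### Partitions and half-partitions

All indices start from `1`, as in the usual notation. A vector `(l_1, …, l_n)` is stored as a function
`ℕ → ℝ` that vanishes outside `{1, …, n}`; in the same way a finite array is stored as a function
`ℕ → ℕ → ℝ` that vanishes outside its index set. -/

/-- `x ∈ ℤ_{≥0}`. -/
def IsNonnegInt (x : ℝ) : Prop := ∃ k : ℕ, x = k

/-- `x ∈ 1/2 + ℤ_{≥0}`. -/
def IsNonnegHalfInt (x : ℝ) : Prop := ∃ k : ℕ, x = k + 1 / 2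

/-- `l = (l_1, …, l_n)` with real parts `l_1 ≥ l_2 ≥ ⋯ ≥ l_n ≥ 0`. -/
structure IsRealPartition (n : ℕ) (l : ℕ → ℝ) : Prop where
  support : ∀ i, ¬ (1 ≤ i ∧ i ≤ n) → l i = 0
  nonneg : ∀ i, 1 ≤ i → i ≤ n → 0 ≤ l i
  anti : ∀ i, 1 ≤ i → i + 1 ≤ n → l (i + 1) ≤ l i

/-- `n`-partitions: all parts are integers. -/
def IsPartition (n : ℕ) (l : ℕ → ℝ) : Prop :=
  IsRealPartition n l ∧ ∀ i, 1 ≤ i → i ≤ n → IsNonnegInt (l i)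

/-- `n`-half-partitions: all parts are half-integers, i.e. halves of odd integers. -/
def IsHalfPartition (n : ℕ) (l : ℕ → ℝ) : Prop :=
  IsRealPartition n l ∧ ∀ i, 1 ≤ i → i ≤ n → IsNonnegHalfInt (l i)

/-- The index set `l ⊆ u^(n) = (u, …, u)` of the bounded sums: all `n`-partitions (if `u` is an integer),
respectively all `n`-half-partitions (if `u` is a half-integer), whose parts are at most `u`. -/
def boundedPartitions (n : ℕ) (u : ℝ) : Set (ℕ → ℝ) :=
  {l | ((IsNonnegInt u ∧ IsPartition n l) ∨ (IsNonnegHalfInt u ∧ IsHalfPartition n l)) ∧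
    ∀ i, 1 ≤ i → i ≤ n → l i ≤ u}

/-! ### Split orthogonal patterns and the CB-interpolating Schur polynomials -/

/-- The index set `{(i,j) : 1 ≤ i ≤ 2n, 1 ≤ j ≤ ⌈i/2⌉}`. -/
def halfTriangle (n : ℕ) : Finset (ℕ × ℕ) :=
  (Finset.Icc 1 (2 * n) ×ˢ Finset.Icc 1 n).filter fun q => q.2 ≤ (q.1 + 1) / 2

/-- Split orthogonal patterns of height `2n`. An entry `z_{i,j}` is an odd end if `i = 2j - 1`. -/
structure IsSplitOrthogonalPattern (n : ℕ) (z : ℕ → ℕ → ℝ) : Prop where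
  support : ∀ i j, (i, j) ∉ halfTriangle n → z i j = 0
  /-- The odd ends are in `(1/2) ℤ_{≥0}`. -/
  odd_end : ∀ i, 1 ≤ i → i ≤ n → IsNonnegInt (z (2 * i - 1) i) ∨ IsNonnegHalfInt (z (2 * i - 1) i)
  /-- The other entries are all non-negative integers or all non-negative half-integers. -/
  other : (∀ i j, (i, j) ∈ halfTriangle n → i ≠ 2 * j - 1 → IsNonnegInt (z i j)) ∨
    (∀ i j, (i, j) ∈ halfTriangle n → i ≠ 2 * j - 1 → IsNonnegHalfInt (z i j))
  /-- Interlacing of consecutive rows (with the convention that entries outside the array are `0`). -/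
  interlacing : ∀ i j, (i, j) ∈ halfTriangle n → i + 1 ≤ 2 * n →
    z (i + 1) (j + 1) ≤ z i j ∧ z i j ≤ z (i + 1) j

/-- The split orthogonal patterns of height `2n` and shape (i.e. bottom row) `l`. -/
def splitOrthogonalPatterns (n : ℕ) (l : ℕ → ℝ) : Set (ℕ → ℕ → ℝ) :=
  {z | IsSplitOrthogonalPattern n z ∧ ∀ j, 1 ≤ j → j ≤ n → z (2 * n) j = l j}

/-- The sum of the `i`-th row of a half-triangular array. -/
def rowSum (z : ℕ → ℕ → ℝ) (i : ℕ) : ℝ := ∑ j ∈ Finset.Icc 1 ((i + 1) / 2), z i j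

/-- The `i`-th component of the type of a half-triangular array, for `i ≥ 1`. -/
def patternType (z : ℕ → ℕ → ℝ) (i : ℕ) : ℝ := rowSum z i - rowSum z (i - 1)

/-- An entry is atypical if it is a half-integer while `z_{2n,1}` is an integer, or the other way round. -/
def IsAtypical (n : ℕ) (z : ℕ → ℕ → ℝ) (i j : ℕ) : Prop :=
  (IsNonnegInt (z (2 * n) 1) ∧ IsNonnegHalfInt (z i j)) ∨
    (IsNonnegHalfInt (z (2 * n) 1) ∧ IsNonnegInt (z i j))

open Classical in
/-- The number of atypical entries. -/
def atypicalCount (n : ℕ) (z : ℕ → ℕ → ℝ) : ℕ :=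
  ((halfTriangle n).filter fun q => IsAtypical n z q.1 q.2).card

/-- The CB-interpolating Schur polynomial in `x = (x_1, …, x_n)` with parameter `β`, indexed by an
`n`-partition or `n`-half-partition `l`. The sum is finite, see `splitOrthogonalPatterns_finite`. -/
def transCB (n : ℕ) (l : ℕ → ℝ) (x : ℕ → ℝ) (β : ℝ) : ℝ :=
  ∑ᶠ z ∈ splitOrthogonalPatterns n l,
    β ^ atypicalCount n z *
      ∏ i ∈ Finset.Icc 1 n, x i ^ (patternType z (2 * i) - patternType z (2 * i - 1))

/-! ### Last passage percolation -/

/-- Directed paths from `a` to `b`: finite sequences of points with steps `(1,0)` or `(0,1)`. -/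
def IsDirectedPath (a b : ℕ × ℕ) (π : List (ℕ × ℕ)) : Prop :=
  π.head? = some a ∧ π.getLast? = some b ∧
    π.IsChain fun q r => r = (q.1 + 1, q.2) ∨ r = (q.1, q.2 + 1)

/-- The total weights collected along the directed paths from `(1,1)` to `(m,n)`. -/
def pathWeights (W : ℕ → ℕ → ℕ) (m n : ℕ) : Set ℕ :=
  {s | ∃ π, IsDirectedPath (1, 1) (m, n) π ∧ s = (π.map fun q => W q.1 q.2).sum}

/-- The point-to-point last passage time from `(1,1)` to `(m,n)`: the maximal total weight of a directed
path. It is a maximum, see `isGreatest_lastPassageTime`. -/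
def lastPassageTime (W : ℕ → ℕ → ℕ) (m n : ℕ) : ℕ := sSup (pathWeights W m n)

/-! ### The doubly symmetric model -/

/-- The sites on or above both the diagonal and the antidiagonal of the `2n × 2n` square:
`1 ≤ i ≤ j ≤ 2n - i + 1`. -/
def fundamentalSites (n : ℕ) : Finset (ℕ × ℕ) :=
  (Finset.Icc 1 (2 * n) ×ˢ Finset.Icc 1 (2 * n)).filter fun q => q.1 ≤ q.2 ∧ q.1 + q.2 ≤ 2 * n + 1

/-- The probability that the weight at the site `(i,j)`, `1 ≤ i ≤ j ≤ 2n - i + 1`, equals `k`. -/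
def weightProb (n : ℕ) (p : ℕ → ℝ) (α β : ℝ) (i j k : ℕ) : ℝ :=
  if i = j then (1 - α * p j) * (α * p j) ^ k
  else if i + j = 2 * n + 1 then (1 - p j ^ 2) / (1 + β * p j) * β ^ (k % 2) * p j ^ k
  else (1 - p i * p j) * (p i * p j) ^ k

/-- `W = (W_{i,j})`, `1 ≤ i, j ≤ 2n`, is a random array of non-negative integers that is symmetric about
the antidiagonal and the diagonal, whose weights on or above both of these are independent and distributed
according to `weightProb`. -/
structure IsDoublySymmetricWeights {Ω : Type*} [MeasurableSpace Ω] (μ : Measure Ω) (n : ℕ) (p : ℕ → ℝ)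
    (α β : ℝ) (W : ℕ → ℕ → Ω → ℕ) : Prop where
  measurable : ∀ i ∈ Finset.Icc 1 (2 * n), ∀ j ∈ Finset.Icc 1 (2 * n), Measurable (W i j)
  symm_antidiagonal : ∀ i ∈ Finset.Icc 1 (2 * n), ∀ j ∈ Finset.Icc 1 (2 * n), ∀ ω,
    W i j ω = W (2 * n + 1 - j) (2 * n + 1 - i) ω
  symm_diagonal : ∀ i ∈ Finset.Icc 1 (2 * n), ∀ j ∈ Finset.Icc 1 (2 * n), ∀ ω, W i j ω = W j i ω
  indep : iIndepFun (fun q : fundamentalSites n => W q.1.1 q.1.2) μ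
  law : ∀ i j, (i, j) ∈ fundamentalSites n → ∀ k : ℕ,
    μ.real {ω | W i j ω = k} = weightProb n p α β i j k

/-- The normalization constant of the joint distribution of the weights. -/
def normalization (n : ℕ) (p : ℕ → ℝ) (α β : ℝ) : ℝ :=
  (∏ q ∈ (Finset.Icc 1 n ×ˢ Finset.Icc 1 n).filter (fun q => q.1 < q.2),
      1 / (1 - p q.1 * p q.2) ^ 2) *
    ∏ j ∈ Finset.Icc 1 n, (1 + β * p j) / (1 - p j ^ 2) * (1 / (1 - α * p j))

/-! ### The sums are finite and the maximum is attained -/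

theorem finite_half_values (B : ℝ) :
    {x : ℝ | (IsNonnegInt x ∨ IsNonnegHalfInt x) ∧ x ≤ B}.Finite := by
  refine ((Set.finite_Iic ⌈2 * B⌉₊).image (fun k : ℕ => (k : ℝ) / 2)).subset ?_
  rintro x ⟨hx, hB⟩
  have key : ∃ k : ℕ, x = (k : ℝ) / 2 := by
    rcases hx with ⟨k, rfl⟩ | ⟨k, rfl⟩
    · exact ⟨2 * k, by push_cast; ring⟩
    · exact ⟨2 * k + 1, by push_cast; ring⟩
  obtain ⟨k, rfl⟩ := key
  refine ⟨k, ?_, rfl⟩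
  have h1 : (k : ℝ) ≤ 2 * B := by linarith
  exact_mod_cast h1.trans (Nat.le_ceil _)

theorem boundedPartitions_finite (n : ℕ) (u : ℝ) : (boundedPartitions n u).Finite := by
  have hfin : (Set.pi Set.univ (fun _ : Finset.Icc 1 n =>
      {x : ℝ | (IsNonnegInt x ∨ IsNonnegHalfInt x) ∧ x ≤ u})).Finite :=
    Set.Finite.pi' (fun _ => finite_half_values u) |>.subset (fun f hf i => hf i trivial)
  refine Set.Finite.of_injOn (f := fun (l : ℕ → ℝ) (i : Finset.Icc 1 n) => l i.1) ?_ ?_ hfin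
  · rintro l ⟨hl, hu⟩ i -
    have hi := Finset.mem_Icc.1 i.2
    refine ⟨?_, hu _ hi.1 hi.2⟩
    rcases hl with ⟨-, -, hl⟩ | ⟨-, -, hl⟩
    · exact Or.inl (hl _ hi.1 hi.2)
    · exact Or.inr (hl _ hi.1 hi.2)
  · have hs : ∀ l ∈ boundedPartitions n u, ∀ i, ¬ (1 ≤ i ∧ i ≤ n) → l i = 0 := by
      rintro l ⟨⟨-, hl, -⟩ | ⟨-, hl, -⟩, -⟩ <;> exact hl.support
    intro l hl l' hl' h
    funext i
    by_cases hi : 1 ≤ i ∧ i ≤ n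
    · exact congrFun h ⟨i, Finset.mem_Icc.2 hi⟩
    · rw [hs l hl i hi, hs l' hl' i hi]

theorem splitOrthogonalPatterns_finite (n : ℕ) (l : ℕ → ℝ) :
    (splitOrthogonalPatterns n l).Finite := by
  set B : ℝ := ∑ j ∈ Finset.Icc 1 n, |l j| with hB
  have hfin : (Set.pi Set.univ (fun _ : halfTriangle n =>
      {x : ℝ | (IsNonnegInt x ∨ IsNonnegHalfInt x) ∧ x ≤ B})).Finite :=
    Set.Finite.pi' (fun _ => finite_half_values B) |>.subset (fun f hf i => hf i trivial)
  refine Set.Finite.of_injOn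
    (f := fun (z : ℕ → ℕ → ℝ) (q : halfTriangle n) => z q.1.1 q.1.2) ?_ ?_ hfin
  · rintro z ⟨hz, hs⟩ ⟨⟨i, j⟩, hij⟩ -
    have mem : ∀ i j, (i, j) ∈ halfTriangle n ↔
        (1 ≤ i ∧ i ≤ 2 * n) ∧ (1 ≤ j ∧ j ≤ n) ∧ j ≤ (i + 1) / 2 := by
      intro i j; simp [halfTriangle, and_assoc]
    refine ⟨?_, ?_⟩
    · by_cases hodd : i = 2 * j - 1
      · subst hodd
        have h := (mem _ _).1 hij
        exact hz.odd_end j h.2.1.1 h.2.1.2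
      · rcases hz.other with h | h
        · exact Or.inl (h i j hij hodd)
        · exact Or.inr (h i j hij hodd)
    · have step : ∀ d i j, (i, j) ∈ halfTriangle n → i + d = 2 * n → z i j ≤ l j := by
        intro d
        induction d with
        | zero =>
          intro i j hij hd
          have h := (mem _ _).1 hij
          have hi : i = 2 * n := by omega
          rw [hi, hs j h.2.1.1 h.2.1.2]
        | succ d ih =>
          intro i j hij hd
          have h := (mem _ _).1 hij
          refine (hz.interlacing i j hij (by omega)).2.trans (ih (i + 1) j ?_ (by omega))
          rw [mem]; omega
      have h := (mem _ _).1 hij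
      refine (step (2 * n - i) i j hij (by omega)).trans ((le_abs_self _).trans ?_)
      exact Finset.single_le_sum (f := fun j => |l j|) (fun _ _ => abs_nonneg _)
        (Finset.mem_Icc.2 h.2.1)
  · rintro z ⟨hz, -⟩ z' ⟨hz', -⟩ h
    funext i j
    by_cases hij : (i, j) ∈ halfTriangle n
    · exact congrFun h ⟨(i, j), hij⟩
    · rw [hz.support i j hij, hz'.support i j hij]

theorem IsDirectedPath.sum_le (W : ℕ → ℕ → ℕ) (b : ℕ × ℕ) (π : List (ℕ × ℕ)) :
    ∀ a, IsDirectedPath a b π →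
      a ≤ b ∧ (π.map fun q => W q.1 q.2).sum ≤ ∑ q ∈ Finset.Icc a b, W q.1 q.2 := by
  induction π with
  | nil => rintro a ⟨h, -⟩; simp at h
  | cons c t ih =>
    rintro a ⟨h1, h2, h3⟩
    obtain rfl : c = a := by simpa using h1
    cases t with
    | nil =>
      obtain rfl : c = b := by simpa using h2
      simp
    | cons d t =>
      rw [List.isChain_cons_cons] at h3
      obtain ⟨hle, hsum⟩ := ih d ⟨rfl, by simpa using h2, h3.2⟩
      have hcd : c ≤ d ∧ ¬ d ≤ c := by
        rcases h3.1 with rfl | rfl <;> constructor <;> simp [Prod.le_def]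
      refine ⟨hcd.1.trans hle, ?_⟩
      have hnot : c ∉ Finset.Icc d b := fun h => hcd.2 (Finset.mem_Icc.1 h).1
      rw [List.map_cons, List.sum_cons]
      calc W c.1 c.2 + ((d :: t).map fun q => W q.1 q.2).sum
          ≤ W c.1 c.2 + ∑ q ∈ Finset.Icc d b, W q.1 q.2 := by gcongr
        _ = ∑ q ∈ insert c (Finset.Icc d b), W q.1 q.2 := by rw [Finset.sum_insert hnot]
        _ ≤ ∑ q ∈ Finset.Icc c b, W q.1 q.2 := by
          refine Finset.sum_le_sum_of_subset ?_
          rw [Finset.insert_subset_iff]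
          exact ⟨Finset.mem_Icc.2 ⟨le_rfl, hcd.1.trans hle⟩, Finset.Icc_subset_Icc_left hcd.1⟩

theorem exists_isDirectedPath (m n : ℕ) :
    ∃ π, IsDirectedPath (1, 1) (m + 1, n + 1) π := by
  have ext : ∀ a b c : ℕ × ℕ, (c = (b.1 + 1, b.2) ∨ c = (b.1, b.2 + 1)) →
      (∃ π, IsDirectedPath a b π) → ∃ π, IsDirectedPath a c π := by
    rintro a b c hc ⟨π, h1, h2, h3⟩
    refine ⟨π ++ [c], by simp [h1], by simp, ?_⟩
    rw [List.isChain_append]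
    refine ⟨h3, by simp, ?_⟩
    intro x hx y hy
    rw [h2] at hx
    obtain rfl : b = x := by simpa using hx
    obtain rfl : c = y := by simpa using hy
    exact hc
  induction m with
  | zero =>
    induction n with
    | zero => exact ⟨[(1, 1)], by simp [IsDirectedPath]⟩
    | succ n ih => exact ext _ _ _ (Or.inr rfl) ih
  | succ m ih => exact ext _ _ _ (Or.inl rfl) ih

theorem isGreatest_lastPassageTime (W : ℕ → ℕ → ℕ) {m n : ℕ} (hm : 1 ≤ m) (hn : 1 ≤ n) :
    IsGreatest (pathWeights W m n) (lastPassageTime W m n) := by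
  have hb : BddAbove (pathWeights W m n) := by
    refine ⟨∑ q ∈ Finset.Icc (1, 1) (m, n), W q.1 q.2, ?_⟩
    rintro s ⟨π, hπ, rfl⟩
    exact (hπ.sum_le W).2
  obtain ⟨m, rfl⟩ := Nat.exists_eq_add_of_le' hm
  obtain ⟨n, rfl⟩ := Nat.exists_eq_add_of_le' hn
  obtain ⟨π, hπ⟩ := exists_isDirectedPath m n
  exact ⟨Nat.sSup_mem ⟨_, π, hπ, rfl⟩ hb, fun s hs => le_csSup hb hs⟩

end SymLPP

end

namespace SymLPP

/-! ### Local moves on staircase arrays -/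

/-- Insertion of the layer `i + j = s` of `w` into an array `t` supported on `i + j < s`: the entries on
the diagonals that meet the new layer are toggled. -/
def layerMove (s : ℕ) (w t : ℕ → ℕ → ℤ) (i j : ℕ) : ℤ :=
  if 1 ≤ i ∧ 1 ≤ j ∧ i + j ≤ s ∧ (i + j) % 2 = s % 2 then
    max (t (i - 1) j) (t i (j - 1)) +
      if i + j = s then w i j else min (t (i + 1) j) (t i (j + 1)) - t i j
  else t i j

/-- The output of the Robinson-Schensted-Knuth correspondence on the staircase array
`(w i j)`, `i + j ≤ s`. -/
def rsk (w : ℕ → ℕ → ℤ) : ℕ → ℕ → ℕ → ℤ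
  | 0 => fun _ _ => 0
  | s + 1 => layerMove (s + 1) w (rsk w s)

/-- Non-negative arrays on `{(i,j) : i, j ≥ 1, i + j ≤ s}` that are weakly increasing in `i` and `j`. -/
structure IsStaircase (s : ℕ) (t : ℕ → ℕ → ℤ) : Prop where
  support : ∀ i j, ¬ (1 ≤ i ∧ 1 ≤ j ∧ i + j ≤ s) → t i j = 0
  nonneg : ∀ i j, 0 ≤ t i j
  mono_left : ∀ i j, 1 ≤ j → i + 1 + j ≤ s → t i j ≤ t (i + 1) j
  mono_right : ∀ i j, 1 ≤ i → i + j + 1 ≤ s → t i j ≤ t i (j + 1)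

theorem layerMove_of_not {s : ℕ} {w t : ℕ → ℕ → ℤ} {i j : ℕ}
    (h : ¬ (1 ≤ i ∧ 1 ≤ j ∧ i + j ≤ s ∧ (i + j) % 2 = s % 2)) : layerMove s w t i j = t i j :=
  if_neg h

theorem layerMove_of_lt {s : ℕ} {w t : ℕ → ℕ → ℤ} {i j : ℕ} (h : i + 1 + (j + 1) < s)
    (h2 : (i + j) % 2 = s % 2) : layerMove s w t (i + 1) (j + 1) =
      max (t i (j + 1)) (t (i + 1) j) + (min (t (i + 1 + 1) (j + 1)) (t (i + 1) (j + 1 + 1)) -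
        t (i + 1) (j + 1)) := by
  unfold layerMove
  rw [if_pos (by omega), if_neg (by omega)]
  rfl

theorem layerMove_of_eq {s : ℕ} {w t : ℕ → ℕ → ℤ} {i j : ℕ} (h : i + 1 + (j + 1) = s) :
    layerMove s w t (i + 1) (j + 1) = max (t i (j + 1)) (t (i + 1) j) + w (i + 1) (j + 1) := by
  unfold layerMove
  rw [if_pos (by omega), if_pos (by omega)]
  rfl

theorem IsStaircase.layerMove {s : ℕ} {w t : ℕ → ℕ → ℤ} (ht : IsStaircase s t)
    (hw : ∀ i j, 0 ≤ w i j) : IsStaircase (s + 1) (layerMove (s + 1) w t) := by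
  refine ⟨?_, ?_, ?_, ?_⟩
  · intro i j h
    rw [layerMove_of_not (by omega)]
    exact ht.support i j (by omega)
  · intro i j
    by_cases h : 1 ≤ i ∧ 1 ≤ j ∧ i + j ≤ s + 1 ∧ (i + j) % 2 = (s + 1) % 2
    · obtain ⟨i, rfl⟩ := Nat.exists_eq_add_of_le' h.1
      obtain ⟨j, rfl⟩ := Nat.exists_eq_add_of_le' h.2.1
      have h0 := ht.nonneg i (j + 1)
      by_cases h1 : i + 1 + (j + 1) = s + 1
      · rw [layerMove_of_eq h1]
        have := hw (i + 1) (j + 1)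
        omega
      · rw [layerMove_of_lt (by omega) (by omega)]
        have := ht.mono_left (i + 1) (j + 1) (by omega) (by omega)
        have := ht.mono_right (i + 1) (j + 1) (by omega) (by omega)
        omega
    · rw [layerMove_of_not h]
      exact ht.nonneg i j
  · intro i j hj hij
    obtain ⟨j, rfl⟩ := Nat.exists_eq_add_of_le' hj
    by_cases hp : (i + (j + 1)) % 2 = (s + 1) % 2
    · rw [layerMove_of_not (i := i + 1) (by omega)]
      rcases i with - | i
      · rw [layerMove_of_not (by omega), ht.support 0 _ (by omega)]
        exact ht.nonneg _ _
      · rw [layerMove_of_lt (by omega) (by omega)]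
        have := ht.mono_left i (j + 1) (by omega) (by omega)
        have := ht.mono_right (i + 1) j (by omega) (by omega)
        omega
    · rw [layerMove_of_not (i := i) (by omega)]
      by_cases h1 : i + 1 + (j + 1) = s + 1
      · rw [layerMove_of_eq h1]
        have := hw (i + 1) (j + 1)
        omega
      · rw [layerMove_of_lt (by omega) (by omega)]
        have := ht.mono_left (i + 1) (j + 1) (by omega) (by omega)
        have := ht.mono_right (i + 1) (j + 1) (by omega) (by omega)
        omega
  · intro i j hi hij
    obtain ⟨i, rfl⟩ := Nat.exists_eq_add_of_le' hi
    by_cases hp : (i + 1 + j) % 2 = (s + 1) % 2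
    · rw [layerMove_of_not (j := j + 1) (by omega)]
      rcases j with - | j
      · rw [layerMove_of_not (by omega), ht.support _ 0 (by omega)]
        exact ht.nonneg _ _
      · rw [layerMove_of_lt (by omega) (by omega)]
        have := ht.mono_left i (j + 1) (by omega) (by omega)
        have := ht.mono_right (i + 1) j (by omega) (by omega)
        omega
    · rw [layerMove_of_not (j := j) (by omega)]
      by_cases h1 : i + 1 + (j + 1) = s + 1
      · rw [layerMove_of_eq h1]
        have := hw (i + 1) (j + 1)
        omega
      · rw [layerMove_of_lt (by omega) (by omega)]
        have := ht.mono_left (i + 1) (j + 1) (by omega) (by omega)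
        have := ht.mono_right (i + 1) (j + 1) (by omega) (by omega)
        omega

theorem isStaircase_rsk {w : ℕ → ℕ → ℤ} (hw : ∀ i j, 0 ≤ w i j) (s : ℕ) :
    IsStaircase s (rsk w s) := by
  induction s with
  | zero => constructor <;> intros <;> simp [rsk]
  | succ s ih => exact ih.layerMove hw

theorem rsk_congr {w w' : ℕ → ℕ → ℤ} {s : ℕ}
    (h : ∀ i j, 1 ≤ i → 1 ≤ j → i + j ≤ s → w i j = w' i j) : rsk w s = rsk w' s := by
  induction s with
  | zero => rfl
  | succ s ih =>
    rw [rsk, rsk, ih fun i j hi hj hij => h i j hi hj (by omega)]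
    funext i j
    unfold layerMove
    split_ifs with h1 h2
    · rw [h i j h1.1 h1.2.1 h2.le]
    · rfl
    · rfl

theorem layerMove_transpose (s : ℕ) (w t : ℕ → ℕ → ℤ) (i j : ℕ) :
    layerMove s (fun i j => w j i) (fun i j => t j i) i j = layerMove s w t j i := by
  unfold layerMove
  simp only [add_comm i j, max_comm (t j (i - 1)), min_comm (t j (i + 1))]
  congr 1
  exact propext ⟨fun h => ⟨h.2.1, h.1, h.2.2⟩, fun h => ⟨h.2.1, h.1, h.2.2⟩⟩

theorem rsk_transpose (w : ℕ → ℕ → ℤ) (s : ℕ) :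
    rsk (fun i j => w j i) s = fun i j => rsk w s j i := by
  induction s with
  | zero => rfl
  | succ s ih =>
    funext i j
    rw [rsk, ih, layerMove_transpose]
    rfl

/-- The inverse of `layerMove` on the array. -/
def layerUndo (s : ℕ) (t : ℕ → ℕ → ℤ) (i j : ℕ) : ℤ :=
  if 1 ≤ i ∧ 1 ≤ j ∧ i + j < s ∧ (i + j) % 2 = s % 2 then
    max (t (i - 1) j) (t i (j - 1)) + min (t (i + 1) j) (t i (j + 1)) - t i j
  else if i + j = s then 0 else t i j

theorem layerUndo_of_lt {s : ℕ} {t : ℕ → ℕ → ℤ} {i j : ℕ} (h : i + 1 + (j + 1) < s)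
    (h2 : (i + j) % 2 = s % 2) : layerUndo s t (i + 1) (j + 1) =
      max (t i (j + 1)) (t (i + 1) j) + min (t (i + 1 + 1) (j + 1)) (t (i + 1) (j + 1 + 1)) -
        t (i + 1) (j + 1) := by
  unfold layerUndo
  rw [if_pos (by omega)]
  rfl

theorem layerUndo_of_ne {s : ℕ} {t : ℕ → ℕ → ℤ} {i j : ℕ} (h : (i + j) % 2 ≠ s % 2) :
    layerUndo s t i j = t i j := by
  unfold layerUndo
  rw [if_neg (by omega), if_neg (by rintro rfl; exact h rfl)]

theorem layerUndo_eq_zero {s : ℕ} {t : ℕ → ℕ → ℤ} (ht : IsStaircase s t) {i j : ℕ}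
    (h : ¬ (1 ≤ i ∧ 1 ≤ j ∧ i + j < s)) : layerUndo s t i j = 0 := by
  unfold layerUndo
  rw [if_neg (by omega)]
  split_ifs with h1
  · rfl
  · exact ht.support i j (by omega)

theorem IsStaircase.layerUndo {s : ℕ} {t : ℕ → ℕ → ℤ} (ht : IsStaircase (s + 1) t) :
    IsStaircase s (layerUndo (s + 1) t) := by
  refine ⟨?_, ?_, ?_, ?_⟩
  · intro i j h
    exact layerUndo_eq_zero ht (by omega)
  · intro i j
    by_cases h : 1 ≤ i ∧ 1 ≤ j ∧ i + j < s + 1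
    · by_cases hp : (i + j) % 2 = (s + 1) % 2
      · obtain ⟨i, rfl⟩ := Nat.exists_eq_add_of_le' h.1
        obtain ⟨j, rfl⟩ := Nat.exists_eq_add_of_le' h.2.1
        rw [layerUndo_of_lt (by omega) (by omega)]
        have := ht.nonneg i (j + 1)
        have := ht.mono_left (i + 1) (j + 1) (by omega) (by omega)
        have := ht.mono_right (i + 1) (j + 1) (by omega) (by omega)
        omega
      · rw [layerUndo_of_ne hp]
        exact ht.nonneg i j
    · rw [layerUndo_eq_zero ht h]
  · intro i j hj hij
    obtain ⟨j, rfl⟩ := Nat.exists_eq_add_of_le' hj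
    by_cases hp : (i + (j + 1)) % 2 = (s + 1) % 2
    · rw [layerUndo_of_ne (i := i + 1) (by omega)]
      rcases i with - | i
      · rw [layerUndo_eq_zero ht (by omega)]
        exact ht.nonneg _ _
      · rw [layerUndo_of_lt (by omega) (by omega)]
        have := ht.mono_left i (j + 1) (by omega) (by omega)
        have := ht.mono_right (i + 1) j (by omega) (by omega)
        omega
    · rw [layerUndo_of_ne (i := i) (by omega), layerUndo_of_lt (by omega) (by omega)]
      have := ht.mono_left (i + 1) (j + 1) (by omega) (by omega)
      have := ht.mono_right (i + 1) (j + 1) (by omega) (by omega)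
      omega
  · intro i j hi hij
    obtain ⟨i, rfl⟩ := Nat.exists_eq_add_of_le' hi
    by_cases hp : (i + 1 + j) % 2 = (s + 1) % 2
    · rw [layerUndo_of_ne (j := j + 1) (by omega)]
      rcases j with - | j
      · rw [layerUndo_eq_zero ht (by omega)]
        exact ht.nonneg _ _
      · rw [layerUndo_of_lt (by omega) (by omega)]
        have := ht.mono_left i (j + 1) (by omega) (by omega)
        have := ht.mono_right (i + 1) j (by omega) (by omega)
        omega
    · rw [layerUndo_of_ne (j := j) (by omega), layerUndo_of_lt (by omega) (by omega)]
      have := ht.mono_left (i + 1) (j + 1) (by omega) (by omega)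
      have := ht.mono_right (i + 1) (j + 1) (by omega) (by omega)
      omega

theorem layerMove_layerUndo {s : ℕ} {w t : ℕ → ℕ → ℤ} (ht : IsStaircase (s + 1) t)
    (hw : ∀ i j, i + 1 + (j + 1) = s + 1 →
      w (i + 1) (j + 1) = t (i + 1) (j + 1) - max (t i (j + 1)) (t (i + 1) j)) :
    layerMove (s + 1) w (layerUndo (s + 1) t) = t := by
  funext i j
  by_cases h : 1 ≤ i ∧ 1 ≤ j ∧ i + j ≤ s + 1 ∧ (i + j) % 2 = (s + 1) % 2
  · obtain ⟨i, rfl⟩ := Nat.exists_eq_add_of_le' h.1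
    obtain ⟨j, rfl⟩ := Nat.exists_eq_add_of_le' h.2.1
    by_cases h1 : i + 1 + (j + 1) = s + 1
    · rw [layerMove_of_eq h1, layerUndo_of_ne (by omega), layerUndo_of_ne (by omega), hw i j h1]
      ring
    · rw [layerMove_of_lt (by omega) (by omega), layerUndo_of_lt (i := i) (j := j) (by omega)
        (by omega), layerUndo_of_ne (i := i) (j := j + 1) (by omega),
        layerUndo_of_ne (i := i + 1) (j := j) (by omega),
        layerUndo_of_ne (i := i + 1 + 1) (j := j + 1) (by omega),
        layerUndo_of_ne (i := i + 1) (j := j + 1 + 1) (by omega)]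
      ring
  · rw [layerMove_of_not h]
    by_cases h2 : 1 ≤ i ∧ 1 ≤ j ∧ i + j < s + 1
    · exact layerUndo_of_ne (by omega)
    · rw [layerUndo_eq_zero ht h2, ht.support]
      omega

theorem layerMove_injective {s : ℕ} {w w' t t' : ℕ → ℕ → ℤ} (ht : IsStaircase s t)
    (ht' : IsStaircase s t') (h : layerMove (s + 1) w t = layerMove (s + 1) w' t') :
    t = t' ∧ ∀ i j, 1 ≤ i → 1 ≤ j → i + j = s + 1 → w i j = w' i j := by
  have h0 : ∀ i j, ¬ (1 ≤ i ∧ 1 ≤ j ∧ i + j ≤ s + 1 ∧ (i + j) % 2 = (s + 1) % 2) →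
      t i j = t' i j := by
    intro i j hij
    have := congrFun (congrFun h i) j
    rwa [layerMove_of_not hij, layerMove_of_not hij] at this
  constructor
  · funext i j
    by_cases h1 : 1 ≤ i ∧ 1 ≤ j ∧ i + j ≤ s + 1 ∧ (i + j) % 2 = (s + 1) % 2
    · by_cases h2 : i + j = s + 1
      · rw [ht.support i j (by omega), ht'.support i j (by omega)]
      · have := congrFun (congrFun h i) j
        obtain ⟨i, rfl⟩ := Nat.exists_eq_add_of_le' h1.1
        obtain ⟨j, rfl⟩ := Nat.exists_eq_add_of_le' h1.2.1
        rw [layerMove_of_lt (by omega) (by omega), layerMove_of_lt (by omega) (by omega),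
          h0 i (j + 1) (by omega), h0 (i + 1) j (by omega), h0 (i + 1 + 1) (j + 1) (by omega),
          h0 (i + 1) (j + 1 + 1) (by omega)] at this
        linarith
    · exact h0 i j h1
  · intro i j hi hj hij
    have := congrFun (congrFun h i) j
    obtain ⟨i, rfl⟩ := Nat.exists_eq_add_of_le' hi
    obtain ⟨j, rfl⟩ := Nat.exists_eq_add_of_le' hj
    rw [layerMove_of_eq hij, layerMove_of_eq hij, h0 i (j + 1) (by omega),
      h0 (i + 1) j (by omega)] at this
    linarith

theorem rsk_injective {w w' : ℕ → ℕ → ℤ} (hw : ∀ i j, 0 ≤ w i j) (hw' : ∀ i j, 0 ≤ w' i j) {s : ℕ}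
    (h : rsk w s = rsk w' s) : ∀ i j, 1 ≤ i → 1 ≤ j → i + j ≤ s → w i j = w' i j := by
  induction s with
  | zero => intro i j hi hj hij; omega
  | succ s ih =>
    obtain ⟨h1, h2⟩ := layerMove_injective (isStaircase_rsk hw s) (isStaircase_rsk hw' s) h
    intro i j hi hj hij
    by_cases h3 : i + j = s + 1
    · exact h2 i j hi hj h3
    · exact ih h1 i j hi hj (by omega)

theorem exists_rsk_eq_succ {s : ℕ} {t w : ℕ → ℕ → ℤ} (ht : IsStaircase (s + 1) t)
    (hw : ∀ i j, 0 ≤ w i j) (h : rsk w s = layerUndo (s + 1) t) :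
    ∃ w', (∀ i j, 0 ≤ w' i j) ∧ (∀ i j, i + j ≤ s → w' i j = w i j) ∧ rsk w' (s + 1) = t ∧
      ∀ i j, i + j = s + 1 → 1 ≤ i → 1 ≤ j → w' i j = t i j - max (t (i - 1) j) (t i (j - 1)) := by
  refine ⟨fun i j => if i + j = s + 1 ∧ 1 ≤ i ∧ 1 ≤ j then
    t i j - max (t (i - 1) j) (t i (j - 1)) else w i j, ?_, ?_, ?_, ?_⟩
  · intro i j
    dsimp only
    split_ifs with h1
    · obtain ⟨i, rfl⟩ := Nat.exists_eq_add_of_le' h1.2.1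
      obtain ⟨j, rfl⟩ := Nat.exists_eq_add_of_le' h1.2.2
      have := ht.mono_left i (j + 1) (by omega) (by omega)
      have := ht.mono_right (i + 1) j (by omega) (by omega)
      simp only [Nat.add_sub_cancel]
      omega
    · exact hw i j
  · intro i j hij
    exact if_neg (by omega)
  · rw [rsk, rsk_congr (w' := w) fun i j _ _ hij => if_neg (by omega), h]
    refine layerMove_layerUndo ht fun i j hij => ?_
    exact if_pos ⟨hij, by omega, by omega⟩
  · intro i j h1 h2 h3
    exact if_pos ⟨h1, h2, h3⟩

theorem layerUndo_even {s : ℕ} {t : ℕ → ℕ → ℤ} (h : ∀ i j, i + j ≤ s → Even (t i j))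
    (ht : IsStaircase (s + 1) t) (i j : ℕ) : Even (layerUndo (s + 1) t i j) := by
  by_cases h1 : 1 ≤ i ∧ 1 ≤ j ∧ i + j < s + 1
  · by_cases hp : (i + j) % 2 = (s + 1) % 2
    · obtain ⟨i, rfl⟩ := Nat.exists_eq_add_of_le' h1.1
      obtain ⟨j, rfl⟩ := Nat.exists_eq_add_of_le' h1.2.1
      rw [layerUndo_of_lt (by omega) (by omega)]
      have a1 := h i (j + 1) (by omega)
      have a2 := h (i + 1) j (by omega)
      have a3 := h (i + 1 + 1) (j + 1) (by omega)
      have a4 := h (i + 1) (j + 1 + 1) (by omega)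
      have a5 := h (i + 1) (j + 1) (by omega)
      rw [Int.even_iff] at *
      omega
    · rw [layerUndo_of_ne hp]
      exact h i j (by omega)
  · rw [layerUndo_eq_zero ht h1]
    exact Even.zero

theorem exists_rsk_eq {s : ℕ} {t : ℕ → ℕ → ℤ} (ht : IsStaircase s t) :
    ∃ w, (∀ i j, 0 ≤ w i j) ∧ rsk w s = t ∧
      ((∀ i j, Even (t i j)) → ∀ i j, 1 ≤ i → 1 ≤ j → i + j ≤ s → Even (w i j)) := by
  induction s generalizing t with
  | zero =>
    refine ⟨fun _ _ => 0, fun _ _ => le_rfl, ?_, fun _ _ _ _ _ _ => Even.zero⟩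
    funext i j
    rw [ht.support i j (by omega)]
    rfl
  | succ s ih =>
    obtain ⟨w, hw, hwt, hev⟩ := ih ht.layerUndo
    obtain ⟨w', hw', h1, h2, h3⟩ := exists_rsk_eq_succ ht hw hwt
    refine ⟨w', hw', h2, fun he i j hi hj hij => ?_⟩
    by_cases h4 : i + j = s + 1
    · rw [h3 i j h4 hi hj]
      have a1 := he i j
      have a2 := he (i - 1) j
      have a3 := he i (j - 1)
      rw [Int.even_iff] at *
      omega
    · rw [h1 i j (by omega)]
      exact hev (layerUndo_even (fun i j _ => he i j) ht) i j hi hj (by omega)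

theorem rsk_even {w : ℕ → ℕ → ℤ} {s : ℕ} (h : ∀ i j, i + j ≤ s → Even (w i j)) (i j : ℕ) :
    Even (rsk w s i j) := by
  induction s generalizing i j with
  | zero => exact Even.zero
  | succ s ih =>
    replace ih := ih fun i j hij => h i j (by omega)
    rw [rsk]
    unfold layerMove
    have a1 := ih (i - 1) j
    have a2 := ih i (j - 1)
    have a3 := ih (i + 1) j
    have a4 := ih i (j + 1)
    have a5 := ih i j
    split_ifs with h1 h2
    · have a6 := h i j (by omega)
      rw [Int.even_iff] at *
      omega
    · rw [Int.even_iff] at *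
      omega
    · exact a5

/-! ### Sums along diagonals -/

/-- The sum of the entries `t a b, t (a-1) (b-1), …` along a diagonal. -/
def diagSum (t : ℕ → ℕ → ℤ) : ℕ → ℕ → ℤ
  | 0, _ => 0
  | _ + 1, 0 => 0
  | a + 1, b + 1 => t (a + 1) (b + 1) + diagSum t a b

/-- The alternating sum `t a a - t (a-1) (a-1) + ⋯` along the main diagonal. -/
def altDiagSum (t : ℕ → ℕ → ℤ) : ℕ → ℤ
  | 0 => 0
  | a + 1 => t (a + 1) (a + 1) - altDiagSum t a

theorem diagSum_succ (t : ℕ → ℕ → ℤ) (a b : ℕ) :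
    diagSum t (a + 1) (b + 1) = t (a + 1) (b + 1) + diagSum t a b := rfl

theorem diagSum_zero_right (t : ℕ → ℕ → ℤ) (a : ℕ) : diagSum t a 0 = 0 := by
  cases a <;> rfl

theorem diagSum_one {s : ℕ} {t : ℕ → ℕ → ℤ} (ht : IsStaircase s t) (b : ℕ) :
    diagSum t 1 b = t 1 b := by
  cases b with
  | zero => rw [ht.support 1 0 (by omega)]; rfl
  | succ b => simp [diagSum]

theorem diagSum_one_right {s : ℕ} {t : ℕ → ℕ → ℤ} (ht : IsStaircase s t) (a : ℕ) :
    diagSum t a 1 = t a 1 := by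
  cases a with
  | zero => rw [ht.support 0 1 (by omega)]; rfl
  | succ b => simp [diagSum, diagSum_zero_right]

theorem diagSum_layerMove_of_lt {s : ℕ} {w t : ℕ → ℕ → ℤ} (ht : IsStaircase s t) {a b : ℕ}
    (x : ℤ) (hab : a + 1 + (b + 1) ≤ s + 1) (hp : (a + b) % 2 = (s + 1) % 2)
    (hx : layerMove (s + 1) w t (a + 1) (b + 1) = max (t a (b + 1)) (t (a + 1) b) + x) :
    diagSum (layerMove (s + 1) w t) (a + 1) (b + 1) + diagSum t a b =
      diagSum t a (b + 1) + diagSum t (a + 1) b + x := by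
  induction a generalizing b x with
  | zero =>
    rw [diagSum_succ, hx, diagSum_one ht, ht.support 0 _ (by omega), max_eq_right (ht.nonneg _ _)]
    simp [diagSum]
  | succ a ih =>
    rcases b with - | b
    · rw [diagSum_succ, hx, diagSum_one_right ht, ht.support _ 0 (by omega),
        max_eq_left (ht.nonneg _ _)]
      simp [diagSum_zero_right]
    · have h := ih (b := b) _ (by omega) (by omega) (layerMove_of_lt (by omega) (by omega))
      rw [diagSum_succ, hx]
      have e1 : diagSum t (a + 1) (b + 1 + 1) = t (a + 1) (b + 1 + 1) + diagSum t a (b + 1) := rfl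
      have e2 : diagSum t (a + 1 + 1) (b + 1) = t (a + 1 + 1) (b + 1) + diagSum t (a + 1) b := rfl
      have e3 : diagSum t (a + 1) (b + 1) = t (a + 1) (b + 1) + diagSum t a b := rfl
      rw [e1, e2]
      have e4 := max_add_min (t (a + 1) (b + 1 + 1)) (t (a + 1 + 1) (b + 1))
      rw [min_comm] at e4
      have e5 : min (t (a + 1 + 1) (b + 1)) (t (a + 1) (b + 1 + 1)) =
        min (t (a + 1 + 1) (b + 1)) (t (a + 1) (b + 1 + 1)) := rfl
      rw [e5] at h
      linarith

theorem diagSum_congr {t t' : ℕ → ℕ → ℤ} {a b : ℕ}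
    (h : ∀ i j, (i + j) % 2 = (a + b) % 2 → t i j = t' i j) : diagSum t a b = diagSum t' a b := by
  induction a generalizing b with
  | zero => rfl
  | succ a ih =>
    rcases b with - | b
    · rfl
    · rw [diagSum, diagSum, h _ _ rfl, ih fun i j hij => h i j (by omega)]

theorem diagSum_rsk {w : ℕ → ℕ → ℤ} (hw : ∀ i j, 0 ≤ w i j) (s : ℕ) {a b : ℕ}
    (h : a + b = s ∨ a + b + 1 = s) :
    diagSum (rsk w s) a b = ∑ i ∈ Finset.Icc 1 a, ∑ j ∈ Finset.Icc 1 b, w i j := by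
  induction s generalizing a b with
  | zero =>
    obtain rfl : a = 0 := by omega
    simp [diagSum]
  | succ s ih =>
    rcases a with - | a
    · simp [diagSum]
    rcases b with - | b
    · simp [diagSum]
    rcases h with h | h
    · have key := diagSum_layerMove_of_lt (w := w) (isStaircase_rsk hw s) (w (a + 1) (b + 1))
        h.le (by omega) (layerMove_of_eq h)
      have h0 := ih (a := a) (b := b) (by omega)
      have h1 := ih (a := a) (b := b + 1) (by omega)
      have h2 := ih (a := a + 1) (b := b) (by omega)
      rw [rsk]
      rw [h0, h1, h2] at key
      simp only [Finset.sum_Icc_succ_top (Nat.le_add_left 1 _), Finset.sum_add_distrib] at key ⊢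
      linarith
    · rw [← ih (Or.inl (by omega)), rsk]
      refine diagSum_congr fun i j hij => layerMove_of_not ?_
      omega

theorem altDiagSum_layerMove {s : ℕ} {w t : ℕ → ℕ → ℤ} (ht : IsStaircase s t)
    (hs : ∀ i j, t i j = t j i) {a : ℕ} (x : ℤ) (ha : a + 1 + (a + 1) ≤ s + 1)
    (hp : (s + 1) % 2 = 0)
    (hx : layerMove (s + 1) w t (a + 1) (a + 1) = t a (a + 1) + x) :
    altDiagSum (layerMove (s + 1) w t) (a + 1) = altDiagSum t a + x := by
  induction a generalizing x with
  | zero => simp [altDiagSum, hx, ht.support 0 _ (by omega)]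
  | succ a ih =>
    have h := ih (t (a + 1) (a + 1 + 1) - t (a + 1) (a + 1)) (by omega) (by
      rw [layerMove_of_lt (by omega) (by omega), hs (a + 1 + 1), min_self, hs (a + 1) a, max_self])
    rw [altDiagSum, hx, h, altDiagSum]
    ring

theorem altDiagSum_congr {t t' : ℕ → ℕ → ℤ} {a : ℕ} (h : ∀ i, t i i = t' i i) :
    altDiagSum t a = altDiagSum t' a := by
  induction a with
  | zero => rfl
  | succ a ih => rw [altDiagSum, altDiagSum, h, ih]

theorem rsk_symm {w : ℕ → ℕ → ℤ} (h : ∀ i j, w i j = w j i) (s i j : ℕ) :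
    rsk w s i j = rsk w s j i := by
  have := rsk_transpose w s
  rw [show (fun i j => w j i) = w from funext fun i => funext fun j => h j i] at this
  exact congrFun (congrFun this i) j

theorem altDiagSum_rsk {w : ℕ → ℕ → ℤ} (hw : ∀ i j, 0 ≤ w i j) (hs : ∀ i j, w i j = w j i)
    (s : ℕ) : altDiagSum (rsk w s) (s / 2) = ∑ i ∈ Finset.Icc 1 (s / 2), w i i := by
  induction s with
  | zero => rfl
  | succ s ih =>
    by_cases hp : (s + 1) % 2 = 0
    · obtain ⟨a, rfl⟩ : ∃ a, s = 2 * a + 1 := ⟨s / 2, by omega⟩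
      have e1 : (2 * a + 1 + 1) / 2 = a + 1 := by omega
      have e2 : (2 * a + 1) / 2 = a := by omega
      rw [e1, rsk, altDiagSum_layerMove (isStaircase_rsk hw _) (rsk_symm hs _) (w (a + 1) (a + 1))
        (by omega) (by omega), Finset.sum_Icc_succ_top (by omega)]
      · rw [e2] at ih
        rw [ih]
      · rw [layerMove_of_eq (by omega), rsk_symm hs _ (a + 1) a, max_self]
    · rw [show (s + 1) / 2 = s / 2 by omega, ← ih, rsk]
      refine altDiagSum_congr fun i => layerMove_of_not ?_
      omega

/-! ### The recursion for last passage times -/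

/-- The last passage times, computed by their recursion. -/
def lppRec (W : ℕ → ℕ → ℕ) : ℕ → ℕ → ℕ
  | 0, _ => 0
  | _ + 1, 0 => 0
  | i + 1, j + 1 => W (i + 1) (j + 1) + max (lppRec W i (j + 1)) (lppRec W (i + 1) j)

theorem lppRec_succ (W : ℕ → ℕ → ℕ) (i j : ℕ) : lppRec W (i + 1) (j + 1) =
    W (i + 1) (j + 1) + max (lppRec W i (j + 1)) (lppRec W (i + 1) j) := by
  rw [lppRec]

theorem lppRec_zero_left (W : ℕ → ℕ → ℕ) (j : ℕ) : lppRec W 0 j = 0 := by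
  rw [lppRec]

theorem lppRec_zero_right (W : ℕ → ℕ → ℕ) (i : ℕ) : lppRec W i 0 = 0 := by
  cases i <;> rw [lppRec]

theorem lppRec_congr {W W' : ℕ → ℕ → ℕ} (i j : ℕ)
    (h : ∀ a b, 1 ≤ a → a ≤ i → 1 ≤ b → b ≤ j → W a b = W' a b) :
    lppRec W i j = lppRec W' i j := by
  induction i generalizing j with
  | zero => rw [lppRec_zero_left, lppRec_zero_left]
  | succ i ih =>
    induction j with
    | zero => rw [lppRec_zero_right, lppRec_zero_right]
    | succ j ihj =>
      rw [lppRec_succ, lppRec_succ, h _ _ (by omega) le_rfl (by omega) le_rfl,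
        ih (j + 1) fun a b h1 h2 h3 h4 => h a b h1 (by omega) h3 h4,
        ihj fun a b h1 h2 h3 h4 => h a b h1 h2 h3 (by omega)]

theorem IsDirectedPath.sum_le_lppRec (W : ℕ → ℕ → ℕ) (π : List (ℕ × ℕ)) (b : ℕ × ℕ)
    (h : IsDirectedPath (1, 1) b π) : (π.map fun q => W q.1 q.2).sum ≤ lppRec W b.1 b.2 := by
  induction π using List.reverseRecOn generalizing b with
  | nil => simp [IsDirectedPath] at h
  | append_singleton l c ih =>
    obtain ⟨h1, h2, h3⟩ := h
    obtain rfl : c = b := by simpa using h2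
    rcases List.eq_nil_or_concat' l with rfl | ⟨l', d, rfl⟩
    · obtain rfl : c = (1, 1) := by simpa using h1
      simp [lppRec_succ W 0 0]
    · have hl : IsDirectedPath (1, 1) d (l' ++ [d]) := by
        refine ⟨?_, by simp, (List.isChain_append.1 h3).1⟩
        cases l' <;> simpa using h1
      have hle := (hl.sum_le W).1
      have hd := ih d hl
      have hstep : c = (d.1 + 1, d.2) ∨ c = (d.1, d.2 + 1) :=
        (List.isChain_append.1 h3).2.2 d (by simp) c (by simp)
      rw [List.map_append, List.sum_append]
      obtain ⟨x, y⟩ := d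
      obtain ⟨hx, hy⟩ : 1 ≤ x ∧ 1 ≤ y := hle
      obtain ⟨x, rfl⟩ := Nat.exists_eq_add_of_le' hx
      obtain ⟨y, rfl⟩ := Nat.exists_eq_add_of_le' hy
      dsimp only at hd
      rcases hstep with rfl | rfl
      · have := lppRec_succ W (x + 1) y
        simp only [List.map_cons, List.map_nil, List.sum_singleton]
        omega
      · have := lppRec_succ W x (y + 1)
        simp only [List.map_cons, List.map_nil, List.sum_singleton]
        omega

theorem IsDirectedPath.concat {a b c : ℕ × ℕ} {π : List (ℕ × ℕ)} (h : IsDirectedPath a b π)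
    (hc : c = (b.1 + 1, b.2) ∨ c = (b.1, b.2 + 1)) : IsDirectedPath a c (π ++ [c]) := by
  obtain ⟨h1, h2, h3⟩ := h
  refine ⟨by simp [h1], by simp, ?_⟩
  rw [List.isChain_append]
  refine ⟨h3, by simp, ?_⟩
  intro x hx y hy
  rw [h2] at hx
  obtain rfl : b = x := by simpa using hx
  obtain rfl : c = y := by simpa using hy
  exact hc

theorem exists_isDirectedPath_sum_eq (W : ℕ → ℕ → ℕ) (i j : ℕ) :
    ∃ π, IsDirectedPath (1, 1) (i + 1, j + 1) π ∧
      lppRec W (i + 1) (j + 1) = (π.map fun q => W q.1 q.2).sum := by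
  induction i generalizing j with
  | zero =>
    induction j with
    | zero => exact ⟨[(1, 1)], by simp [IsDirectedPath], by simp [lppRec]⟩
    | succ j ihj =>
      obtain ⟨π, h1, h2⟩ := ihj
      refine ⟨_, h1.concat (Or.inr rfl), ?_⟩
      rw [lppRec_succ, lppRec_zero_left, h2]
      simp [add_comm]
  | succ i ih =>
    have left : lppRec W (i + 1) (j + 1) ≤ lppRec W (i + 1 + 1) (j + 1) := by
      rw [lppRec_succ W (i + 1)]
      omega
    induction j with
    | zero =>
      obtain ⟨π, h1, h2⟩ := ih 0
      refine ⟨_, h1.concat (Or.inl rfl), ?_⟩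
      rw [lppRec_succ, lppRec_zero_right, h2]
      simp [add_comm]
    | succ j ihj =>
      rcases le_total (lppRec W (i + 1 + 1) (j + 1)) (lppRec W (i + 1) (j + 1 + 1)) with h | h
      · obtain ⟨π, h1, h2⟩ := ih (j + 1)
        refine ⟨_, h1.concat (Or.inl rfl), ?_⟩
        rw [lppRec_succ, max_eq_left h, h2]
        simp [add_comm]
      · obtain ⟨π, h1, h2⟩ := ihj (by rw [lppRec_succ W (i + 1)]; omega)
        refine ⟨_, h1.concat (Or.inr rfl), ?_⟩
        rw [lppRec_succ, max_eq_right h, h2]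
        simp [add_comm]

theorem lastPassageTime_eq_lppRec (W : ℕ → ℕ → ℕ) {i j : ℕ} (hi : 1 ≤ i) (hj : 1 ≤ j) :
    lastPassageTime W i j = lppRec W i j := by
  refine (isGreatest_lastPassageTime W hi hj).unique ⟨?_, ?_⟩
  · obtain ⟨i, rfl⟩ := Nat.exists_eq_add_of_le' hi
    obtain ⟨j, rfl⟩ := Nat.exists_eq_add_of_le' hj
    exact exists_isDirectedPath_sum_eq W i j
  · rintro s ⟨π, hπ, rfl⟩
    exact hπ.sum_le_lppRec W

/-- A path from `(1,1)` to `(N,N)` is cut at its point on the layer `i + j = s + 2`; by symmetry about the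
antidiagonal, its second part is a path from `(1,1)` as well. -/
theorem lppRec_le_iff_layer {W : ℕ → ℕ → ℕ} {N : ℕ}
    (hW : ∀ i j, 1 ≤ i → i ≤ N → 1 ≤ j → j ≤ N → W i j = W (N + 1 - j) (N + 1 - i)) (m : ℕ)
    (s : ℕ) (hs : s + 1 ≤ N) :
    lppRec W N N ≤ m ↔ ∀ i j, i + j = s →
      max (lppRec W i (j + 1)) (lppRec W (i + 1) j) + lppRec W (N - j) (N - i) ≤ m := by
  induction s with
  | zero =>
    constructor
    · intro h i j hij
      obtain ⟨rfl, rfl⟩ : i = 0 ∧ j = 0 := by omega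
      simpa [lppRec_zero_left, lppRec_zero_right] using h
    · intro h
      simpa [lppRec_zero_left, lppRec_zero_right] using h 0 0 rfl
  | succ s ih =>
    rw [ih (by omega)]
    have key : ∀ i j, i + j = s →
        (max (lppRec W i (j + 1)) (lppRec W (i + 1) j) + lppRec W (N - j) (N - i) ≤ m ↔
          lppRec W (i + 1) (j + 1) + lppRec W (N - (j + 1)) (N - i) ≤ m ∧
          lppRec W (i + 1) (j + 1) + lppRec W (N - j) (N - (i + 1)) ≤ m) := by
      intro i j hij
      have e1 := lppRec_succ W i j
      have e2 := lppRec_succ W (N - (j + 1)) (N - (i + 1))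
      rw [show N - (j + 1) + 1 = N - j by omega, show N - (i + 1) + 1 = N - i by omega] at e2
      have e3 := hW (i + 1) (j + 1) (by omega) (by omega) (by omega) (by omega)
      rw [show N + 1 - (j + 1) = N - j by omega, show N + 1 - (i + 1) = N - i by omega] at e3
      omega
    constructor
    · intro h i j hij
      have h1 : lppRec W i (j + 1) + lppRec W (N - j) (N - i) ≤ m ∨ i = 0 := by
        rcases i with - | i
        · exact Or.inr rfl
        · exact Or.inl ((key i j (by omega)).1 (h i j (by omega))).2
      have h2 : lppRec W (i + 1) j + lppRec W (N - j) (N - i) ≤ m ∨ j = 0 := by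
        rcases j with - | j
        · exact Or.inr rfl
        · exact Or.inl ((key i j (by omega)).1 (h i j (by omega))).1
      have h3 : i = 0 → lppRec W i (j + 1) = 0 := by rintro rfl; exact lppRec_zero_left _ _
      have h4 : j = 0 → lppRec W (i + 1) j = 0 := by rintro rfl; exact lppRec_zero_right _ _
      omega
    · intro h i j hij
      rw [key i j hij]
      have h1 := h i (j + 1) (by omega)
      have h2 := h (i + 1) j (by omega)
      constructor <;> omega

/-- The last passage time of an array that is symmetric about the antidiagonal is a point-to-line last
passage time. -/
theorem lppRec_le_iff {W : ℕ → ℕ → ℕ} {N : ℕ} (hN : 1 ≤ N)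
    (hW : ∀ i j, 1 ≤ i → i ≤ N → 1 ≤ j → j ≤ N → W i j = W (N + 1 - j) (N + 1 - i)) (m : ℕ) :
    lppRec W N N ≤ m ↔ ∀ i j, i + 1 + (j + 1) = N + 1 →
      W (i + 1) (j + 1) + 2 * max (lppRec W i (j + 1)) (lppRec W (i + 1) j) ≤ m := by
  rw [lppRec_le_iff_layer hW m (N - 1) (by omega)]
  refine forall₂_congr fun i j => ?_
  refine (imp_congr_left (by omega)).trans (imp_congr_right fun h => ?_)
  rw [show N - j = i + 1 by omega, show N - i = j + 1 by omega, lppRec_succ W i j]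
  omega

theorem rsk_layer_eq_lppRec {w : ℕ → ℕ → ℤ} {W : ℕ → ℕ → ℕ} (hw : ∀ i j, 0 ≤ w i j) {s : ℕ}
    (h : ∀ i j, 1 ≤ i → 1 ≤ j → i + j ≤ s → w i j = 2 * W i j) :
    ∀ i j, i + j = s → rsk w s i j = 2 * lppRec W i j := by
  induction s with
  | zero =>
    intro i j hij
    obtain rfl : i = 0 := by omega
    rw [lppRec_zero_left]
    rfl
  | succ s ih =>
    replace ih := ih fun i j hi hj hij => h i j hi hj (by omega)
    intro i j hij
    rcases i with - | i
    · rw [(isStaircase_rsk hw _).support _ _ (by omega), lppRec_zero_left]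
      rfl
    rcases j with - | j
    · rw [(isStaircase_rsk hw _).support _ _ (by omega), lppRec_zero_right]
      rfl
    rw [rsk, layerMove_of_eq hij, ih i (j + 1) (by omega), ih (i + 1) j (by omega), lppRec_succ,
      h _ _ (by omega) (by omega) hij.le]
    push_cast
    omega

/-- The array `2 W i j` for `i + j < s`, `W i j` for `i + j = s`. -/
def doubledBelow (s : ℕ) (W : ℕ → ℕ → ℕ) (i j : ℕ) : ℤ :=
  if i + j = s then W i j else 2 * W i j

theorem doubledBelow_nonneg (s : ℕ) (W : ℕ → ℕ → ℕ) (i j : ℕ) : 0 ≤ doubledBelow s W i j := by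
  unfold doubledBelow
  split_ifs <;> omega

theorem rsk_doubledBelow {s : ℕ} {W : ℕ → ℕ → ℕ} {i j : ℕ} (h : i + 1 + (j + 1) = s + 1) :
    rsk (doubledBelow (s + 1) W) (s + 1) (i + 1) (j + 1) =
      W (i + 1) (j + 1) + 2 * max (lppRec W i (j + 1)) (lppRec W (i + 1) j) := by
  have key := rsk_layer_eq_lppRec (s := s) (W := W) (doubledBelow_nonneg (s + 1) W)
    fun i j hi hj hij => if_neg (by omega)
  rw [rsk, layerMove_of_eq h, key i (j + 1) (by omega), key (i + 1) j (by omega), doubledBelow,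
    if_pos h]
  omega

/-! ### From weights to arrays -/

theorem mem_fundamentalSites {n i j : ℕ} :
    (i, j) ∈ fundamentalSites n ↔ 1 ≤ i ∧ i ≤ j ∧ i + j ≤ 2 * n + 1 := by
  simp only [fundamentalSites, Finset.mem_filter, Finset.mem_product, Finset.mem_Icc]
  omega

theorem mem_halfTriangle {n i j : ℕ} :
    (i, j) ∈ halfTriangle n ↔ 1 ≤ j ∧ 2 * j ≤ i + 1 ∧ i ≤ 2 * n := by
  simp only [halfTriangle, Finset.mem_filter, Finset.mem_product, Finset.mem_Icc]
  omega

/-- The array that is symmetric about the diagonal, is given by `f` on the fundamental sites, and vanishes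
below the antidiagonal. -/
def symmExtend (n : ℕ) (f : fundamentalSites n → ℕ) (i j : ℕ) : ℕ :=
  if h : (min i j, max i j) ∈ fundamentalSites n then f ⟨_, h⟩ else 0

theorem symmExtend_comm (n : ℕ) (f : fundamentalSites n → ℕ) (i j : ℕ) :
    symmExtend n f i j = symmExtend n f j i := by
  unfold symmExtend
  simp only [min_comm i j, max_comm i j]

theorem symmExtend_apply {n : ℕ} (f : fundamentalSites n → ℕ) (q : fundamentalSites n) :
    symmExtend n f q.1.1 q.1.2 = f q := by
  obtain ⟨⟨i, j⟩, h⟩ := q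
  have h1 := mem_fundamentalSites.1 h
  unfold symmExtend
  simp only [min_eq_left h1.2.1, max_eq_right h1.2.1, h, dif_pos]

/-- The array obtained from the weights on the fundamental sites; the entries are doubled to make them
integers. -/
def outputArray (n : ℕ) (f : fundamentalSites n → ℕ) : ℕ → ℕ → ℤ :=
  rsk (doubledBelow (2 * n + 1) (symmExtend n f)) (2 * n + 1)

theorem doubledBelow_symmExtend_comm (n : ℕ) (f : fundamentalSites n → ℕ) (i j : ℕ) :
    doubledBelow (2 * n + 1) (symmExtend n f) i j =
      doubledBelow (2 * n + 1) (symmExtend n f) j i := by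
  unfold doubledBelow
  rw [symmExtend_comm, add_comm i j]

/-- The possible arrays `outputArray n f` with entries at most `m`. -/
structure IsOutputArray (n m : ℕ) (t : ℕ → ℕ → ℤ) : Prop where
  isStaircase : IsStaircase (2 * n + 1) t
  symm : ∀ i j, t i j = t j i
  even : ∀ i j, i + j ≤ 2 * n → Even (t i j)
  le : ∀ i j, t i j ≤ m

theorem bijOn_outputArray (n m : ℕ) :
    Set.BijOn (outputArray n) {f | ∀ i j, outputArray n f i j ≤ m} {t | IsOutputArray n m t} := by
  refine ⟨?_, ?_, ?_⟩
  · intro f hf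
    refine ⟨isStaircase_rsk (doubledBelow_nonneg _ _) _,
      rsk_symm (doubledBelow_symmExtend_comm n f) _, fun i j hij => ?_, hf⟩
    have h := rsk_even (w := doubledBelow (2 * n + 1) (symmExtend n f)) (s := 2 * n)
      (fun i j hij => by
        unfold doubledBelow
        rw [if_neg (by omega)]
        exact even_two_mul _)
    unfold outputArray
    rw [rsk]
    by_cases hp : 1 ≤ i ∧ 1 ≤ j ∧ i + j ≤ 2 * n + 1 ∧ (i + j) % 2 = (2 * n + 1) % 2
    · obtain ⟨i, rfl⟩ := Nat.exists_eq_add_of_le' hp.1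
      obtain ⟨j, rfl⟩ := Nat.exists_eq_add_of_le' hp.2.1
      rw [layerMove_of_lt (by omega) (by omega)]
      have a1 := h i (j + 1)
      have a2 := h (i + 1) j
      have a3 := h (i + 1 + 1) (j + 1)
      have a4 := h (i + 1) (j + 1 + 1)
      have a5 := h (i + 1) (j + 1)
      rw [Int.even_iff] at *
      omega
    · rw [layerMove_of_not hp]
      exact h i j
  · intro f _ g _ hfg
    funext q
    have hq := mem_fundamentalSites.1 q.2
    have h := rsk_injective (doubledBelow_nonneg _ _) (doubledBelow_nonneg _ _) hfg q.1.1 q.1.2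
      hq.1 (hq.1.trans hq.2.1) hq.2.2
    unfold doubledBelow at h
    rw [symmExtend_apply, symmExtend_apply] at h
    split_ifs at h <;> omega
  · intro t ht
    obtain ⟨w0, hw0, hw0t, hev⟩ := exists_rsk_eq ht.isStaircase.layerUndo
    obtain ⟨w, hw, h1, h2, -⟩ := exists_rsk_eq_succ ht.isStaircase hw0 hw0t
    have hsymm : ∀ i j, 1 ≤ i → 1 ≤ j → i + j ≤ 2 * n + 1 → w i j = w j i := by
      refine rsk_injective hw (fun i j => hw j i) ?_
      refine Eq.trans ?_ (rsk_transpose w (2 * n + 1)).symm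
      rw [h2]
      funext i j
      exact ht.symm i j
    have heven : ∀ i j, 1 ≤ i → 1 ≤ j → i + j ≤ 2 * n → Even (w i j) := by
      intro i j hi hj hij
      rw [h1 i j hij]
      exact hev (layerUndo_even ht.even ht.isStaircase) i j hi hj hij
    let f : fundamentalSites n → ℕ := fun q =>
      if q.1.1 + q.1.2 = 2 * n + 1 then (w q.1.1 q.1.2).toNat else (w q.1.1 q.1.2).toNat / 2
    have hf : outputArray n f = t := by
      rw [← h2, outputArray]
      refine rsk_congr fun i j hi hj hij => ?_
      have hmem : (min i j, max i j) ∈ fundamentalSites n := by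
        rw [mem_fundamentalSites]; omega
      have e1 : w (min i j) (max i j) = w i j := by
        rcases le_total i j with h | h
        · rw [min_eq_left h, max_eq_right h]
        · rw [min_eq_right h, max_eq_left h, hsymm j i hj hi (by omega)]
      have e2 := hw i j
      unfold doubledBelow symmExtend
      rw [dif_pos hmem]
      simp only [f]
      rw [e1, min_add_max]
      split_ifs with h3
      · omega
      · have e3 := heven i j hi hj (by omega)
        rw [Int.even_iff] at e3
        omega
    refine ⟨f, ?_, hf⟩
    intro i j
    rw [hf]
    exact ht.le i j

/-! ### From arrays to split orthogonal patterns -/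

theorem isNonnegInt_half_iff (k : ℤ) : IsNonnegInt ((k : ℝ) / 2) ↔ 0 ≤ k ∧ Even k := by
  constructor
  · rintro ⟨l, hl⟩
    have h : (k : ℝ) = 2 * l := by linarith
    have h2 : k = 2 * l := by exact_mod_cast h
    exact ⟨by omega, by rw [h2]; exact even_two_mul _⟩
  · rintro ⟨h0, l, hl⟩
    refine ⟨l.toNat, ?_⟩
    have h2 : k = 2 * (l.toNat : ℤ) := by omega
    have h : (k : ℝ) = 2 * (l.toNat : ℝ) := by exact_mod_cast h2
    rw [h]
    ring

theorem isNonnegHalfInt_half_iff (k : ℤ) : IsNonnegHalfInt ((k : ℝ) / 2) ↔ 0 ≤ k ∧ Odd k := by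
  constructor
  · rintro ⟨l, hl⟩
    have h : (k : ℝ) = 2 * l + 1 := by linarith
    have h2 : k = 2 * l + 1 := by exact_mod_cast h
    exact ⟨by omega, by rw [h2]; exact odd_two_mul_add_one _⟩
  · rintro ⟨h0, l, hl⟩
    refine ⟨l.toNat, ?_⟩
    have h2 : k = 2 * (l.toNat : ℤ) + 1 := by omega
    have h : (k : ℝ) = 2 * (l.toNat : ℝ) + 1 := by exact_mod_cast h2
    rw [h]
    ring

/-- The pattern obtained by reflecting an array at the height `m / 2`. -/
noncomputable def patternOfArray (n m : ℕ) (t : ℕ → ℕ → ℤ) (i j : ℕ) : ℝ :=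
  if (i, j) ∈ halfTriangle n then (((m : ℤ) - t j (j + (2 * n - i)) : ℤ) : ℝ) / 2 else 0

/-- The split orthogonal patterns of all the shapes in `boundedPartitions n (m / 2)`. -/
def boundedPatterns (n m : ℕ) : Set (ℕ → ℕ → ℝ) :=
  {z | IsSplitOrthogonalPattern n z ∧ z (2 * n) ∈ boundedPartitions n ((m : ℝ) / 2)}

theorem patternOfArray_of_mem {n m : ℕ} {t : ℕ → ℕ → ℤ} {i j : ℕ} (h : (i, j) ∈ halfTriangle n) :
    patternOfArray n m t i j = (((m : ℤ) - t j (j + (2 * n - i)) : ℤ) : ℝ) / 2 :=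
  if_pos h

theorem half_cast_le {a b : ℤ} (h : a ≤ b) : (a : ℝ) / 2 ≤ (b : ℝ) / 2 := by
  have : (a : ℝ) ≤ b := by exact_mod_cast h
  linarith

theorem le_of_half_cast_le {a b : ℤ} (h : (a : ℝ) / 2 ≤ (b : ℝ) / 2) : a ≤ b := by
  have : (a : ℝ) ≤ b := by linarith
  exact_mod_cast this

theorem patternOfArray_mem {n m : ℕ} {t : ℕ → ℕ → ℤ} (ht : IsOutputArray n m t) :
    patternOfArray n m t ∈ boundedPatterns n m := by
  have hs := ht.isStaircase
  have nonneg : ∀ i j, 0 ≤ patternOfArray n m t i j := by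
    intro i j
    unfold patternOfArray
    split_ifs
    · have := ht.le j (j + (2 * n - i))
      have : (0 : ℤ) ≤ m - t j (j + (2 * n - i)) := by omega
      positivity
    · exact le_rfl
  have anti : ∀ i j, (i, j) ∈ halfTriangle n → i + 1 ≤ 2 * n →
      patternOfArray n m t (i + 1) (j + 1) ≤ patternOfArray n m t i j ∧
      patternOfArray n m t i j ≤ patternOfArray n m t (i + 1) j := by
    intro i j hij hi
    have h := mem_halfTriangle.1 hij
    constructor
    · by_cases h1 : (i + 1, j + 1) ∈ halfTriangle n
      · rw [patternOfArray_of_mem h1, patternOfArray_of_mem hij]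
        refine half_cast_le ?_
        have h2 := mem_halfTriangle.1 h1
        rw [show j + 1 + (2 * n - (i + 1)) = j + (2 * n - i) by omega]
        have := hs.mono_left j (j + (2 * n - i)) (by omega) (by omega)
        omega
      · rw [patternOfArray, if_neg h1]
        exact nonneg i j
    · have h1 : (i + 1, j) ∈ halfTriangle n := by rw [mem_halfTriangle]; omega
      rw [patternOfArray_of_mem h1, patternOfArray_of_mem hij]
      refine half_cast_le ?_
      have := hs.mono_right j (j + (2 * n - (i + 1))) (by omega) (by omega)
      rw [show j + (2 * n - (i + 1)) + 1 = j + (2 * n - i) by omega] at this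
      omega
  have int_or : ∀ i j, (i, j) ∈ halfTriangle n → i ≠ 2 * j - 1 →
      (Even m → IsNonnegInt (patternOfArray n m t i j)) ∧
      (Odd m → IsNonnegHalfInt (patternOfArray n m t i j)) := by
    intro i j hij hne
    have h := mem_halfTriangle.1 hij
    have h1 := ht.le j (j + (2 * n - i))
    have h2 := ht.even j (j + (2 * n - i)) (by omega)
    rw [patternOfArray_of_mem hij, isNonnegInt_half_iff, isNonnegHalfInt_half_iff]
    rw [Int.even_iff] at *
    rw [Int.odd_iff, Nat.even_iff, Nat.odd_iff]
    omega
  refine ⟨⟨fun i j h => if_neg h, ?_, ?_, anti⟩, ?_, ?_⟩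
  · intro i hi hin
    have hm : (2 * i - 1, i) ∈ halfTriangle n := by rw [mem_halfTriangle]; omega
    have h1 := ht.le i (i + (2 * n - (2 * i - 1)))
    rw [patternOfArray_of_mem hm, isNonnegInt_half_iff, isNonnegHalfInt_half_iff, Int.even_iff,
      Int.odd_iff]
    omega
  · rcases Nat.even_or_odd m with hm | hm
    · exact Or.inl fun i j hij hne => (int_or i j hij hne).1 hm
    · exact Or.inr fun i j hij hne => (int_or i j hij hne).2 hm
  · have hreal : IsRealPartition n (patternOfArray n m t (2 * n)) := by
      refine ⟨fun i hi => if_neg ?_, fun i _ _ => nonneg _ _, fun i hi hin => ?_⟩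
      · rw [mem_halfTriangle]; omega
      · have h1 : (2 * n, i) ∈ halfTriangle n := by rw [mem_halfTriangle]; omega
        have h2 : (2 * n, i + 1) ∈ halfTriangle n := by rw [mem_halfTriangle]; omega
        rw [patternOfArray_of_mem h1, patternOfArray_of_mem h2]
        refine half_cast_le ?_
        have e1 := hs.mono_left i i (by omega) (by omega)
        have e2 := hs.mono_right (i + 1) i (by omega) (by omega)
        simp only [Nat.sub_self, Nat.add_zero]
        omega
    have hmem : ∀ i, 1 ≤ i → i ≤ n → (2 * n, i) ∈ halfTriangle n ∧ 2 * n ≠ 2 * i - 1 := by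
      intro i h1 h2
      rw [mem_halfTriangle]
      omega
    have e : ((m : ℝ) / 2) = ((m : ℤ) : ℝ) / 2 := by push_cast; rfl
    rw [e, isNonnegInt_half_iff, isNonnegHalfInt_half_iff, Int.even_coe_nat, Int.odd_coe_nat]
    rcases Nat.even_or_odd m with hm | hm
    · exact Or.inl ⟨⟨by omega, hm⟩, hreal, fun i h1 h2 =>
        (int_or _ _ (hmem i h1 h2).1 (hmem i h1 h2).2).1 hm⟩
    · exact Or.inr ⟨⟨by omega, hm⟩, hreal, fun i h1 h2 =>
        (int_or _ _ (hmem i h1 h2).1 (hmem i h1 h2).2).2 hm⟩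
  · intro i h1 h2
    have h3 : (2 * n, i) ∈ halfTriangle n := by rw [mem_halfTriangle]; omega
    rw [patternOfArray_of_mem h3, show ((m : ℝ) / 2) = ((m : ℤ) : ℝ) / 2 by push_cast; rfl]
    refine half_cast_le ?_
    have := hs.nonneg i (i + (2 * n - 2 * n))
    omega

theorem IsSplitOrthogonalPattern.le_bottom {n : ℕ} {z : ℕ → ℕ → ℝ}
    (hz : IsSplitOrthogonalPattern n z) {i j : ℕ} (h : (i, j) ∈ halfTriangle n) :
    z i j ≤ z (2 * n) j := by
  have h1 := mem_halfTriangle.1 h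
  obtain ⟨d, hd⟩ := Nat.exists_eq_add_of_le h1.2.2
  induction d generalizing i with
  | zero => rw [hd]; rfl
  | succ d ih =>
    have h2 : (i + 1, j) ∈ halfTriangle n := by rw [mem_halfTriangle]; omega
    exact (hz.interlacing i j h (by omega)).2.trans
      (ih h2 (mem_halfTriangle.1 h2) (by omega))

/-- The entries of a bounded pattern are halves of integers, of prescribed parity except at the odd ends. -/
theorem exists_int_of_mem_boundedPatterns {n m : ℕ} {z : ℕ → ℕ → ℝ} (hz : z ∈ boundedPatterns n m)
    {i j : ℕ} (h : (i, j) ∈ halfTriangle n) :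
    ∃ k : ℤ, z i j = (k : ℝ) / 2 ∧ 0 ≤ k ∧ k ≤ m ∧ (i ≠ 2 * j - 1 → Even (m - k)) := by
  obtain ⟨hz, hl, hu⟩ := hz
  have h1 := mem_halfTriangle.1 h
  have hle : z i j ≤ ((m : ℤ) : ℝ) / 2 := (hz.le_bottom h).trans (by
    push_cast
    exact hu j h1.1 (by omega))
  have key : ∃ k : ℤ, z i j = (k : ℝ) / 2 := by
    have int : IsNonnegInt (z i j) → ∃ k : ℤ, z i j = (k : ℝ) / 2 := by
      rintro ⟨l, hl⟩
      exact ⟨2 * l, by rw [hl]; push_cast; ring⟩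
    have half : IsNonnegHalfInt (z i j) → ∃ k : ℤ, z i j = (k : ℝ) / 2 := by
      rintro ⟨l, hl⟩
      exact ⟨2 * l + 1, by rw [hl]; push_cast; ring⟩
    by_cases hne : i = 2 * j - 1
    · subst hne
      exact (hz.odd_end j h1.1 (by omega)).elim int half
    · exact hz.other.elim (fun o => int (o i j h hne)) (fun o => half (o i j h hne))
  obtain ⟨k, hk⟩ := key
  have hb : (2 * n, 1) ∈ halfTriangle n := by rw [mem_halfTriangle]; omega
  have hkey : 0 ≤ k ∧ (i ≠ 2 * j - 1 → Even (m - k)) := by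
    have e : ((m : ℝ) / 2) = ((m : ℤ) : ℝ) / 2 := by push_cast; rfl
    rw [e, isNonnegInt_half_iff, isNonnegHalfInt_half_iff] at hl
    refine ⟨?_, fun hne => ?_⟩
    · by_cases hne : i = 2 * j - 1
      · subst hne
        have := hz.odd_end j h1.1 (by omega)
        rw [hk, isNonnegInt_half_iff, isNonnegHalfInt_half_iff] at this
        omega
      · have := hz.other.imp (fun o => o i j h hne) (fun o => o i j h hne)
        rw [hk, isNonnegInt_half_iff, isNonnegHalfInt_half_iff] at this
        omega
    · have hb1 : IsNonnegInt (z (2 * n) 1) → ¬ IsNonnegHalfInt (z (2 * n) 1) := by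
        rintro ⟨a, ha⟩ hc
        rw [ha, show (a : ℝ) = ((2 * a : ℤ) : ℝ) / 2 by push_cast; ring,
          isNonnegHalfInt_half_iff, Int.odd_iff] at hc
        omega
      rcases hl with ⟨hm, -, hl⟩ | ⟨hm, -, hl⟩ <;> rcases hz.other with o | o
      · have := o i j h hne
        rw [hk, isNonnegInt_half_iff] at this
        exact hm.2.sub this.2
      · exact absurd (o _ _ hb (by omega)) (hb1 (hl 1 le_rfl (by omega)))
      · exact absurd (hl 1 le_rfl (by omega)) (hb1 (o _ _ hb (by omega)))
      · have := o i j h hne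
        rw [hk, isNonnegHalfInt_half_iff] at this
        exact hm.2.sub_odd this.2
  refine ⟨k, hk, hkey.1, ?_, hkey.2⟩
  rw [hk] at hle
  exact le_of_half_cast_le hle

theorem bijOn_patternOfArray (n m : ℕ) :
    Set.BijOn (patternOfArray n m) {t | IsOutputArray n m t} (boundedPatterns n m) := by
  refine ⟨fun t ht => patternOfArray_mem ht, ?_, ?_⟩
  · intro t ht t' ht' h
    have key : ∀ i j, i ≤ j → t i j = t' i j := by
      intro i j hle
      by_cases hij : 1 ≤ i ∧ 1 ≤ j ∧ i + j ≤ 2 * n + 1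
      · have hm : (2 * n - (j - i), i) ∈ halfTriangle n := by rw [mem_halfTriangle]; omega
        have := congrFun (congrFun h (2 * n - (j - i))) i
        rw [patternOfArray_of_mem hm, patternOfArray_of_mem hm] at this
        have h1 := le_of_half_cast_le this.le
        have h2 := le_of_half_cast_le this.ge
        rw [show i + (2 * n - (2 * n - (j - i))) = j by omega] at h1 h2
        omega
      · rw [ht.isStaircase.support i j hij, ht'.isStaircase.support i j hij]
    funext i j
    rcases le_total i j with hle | hle
    · exact key i j hle
    · rw [ht.symm, ht'.symm, key j i hle]
  · intro z hz
    have hex : ∀ i j, ∃ k : ℤ, (i, j) ∈ halfTriangle n →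
        z i j = (k : ℝ) / 2 ∧ 0 ≤ k ∧ k ≤ m ∧ (i ≠ 2 * j - 1 → Even (m - k)) := by
      intro i j
      by_cases h : (i, j) ∈ halfTriangle n
      · obtain ⟨k, hk⟩ := exists_int_of_mem_boundedPatterns hz h
        exact ⟨k, fun _ => hk⟩
      · exact ⟨0, fun h' => absurd h' h⟩
    choose k hk using hex
    let t : ℕ → ℕ → ℤ := fun i j => if 1 ≤ i ∧ 1 ≤ j ∧ i + j ≤ 2 * n + 1 then
      m - k (2 * n - (max i j - min i j)) (min i j) else 0
    have hmem : ∀ i j, 1 ≤ i → 1 ≤ j → i + j ≤ 2 * n + 1 →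
        (2 * n - (max i j - min i j), min i j) ∈ halfTriangle n := by
      intro i j hi hj hij
      rw [mem_halfTriangle]
      omega
    have hsymm : ∀ i j, t i j = t j i := by
      intro i j
      simp only [t, max_comm i j, min_comm i j, add_comm i j]
      congr 1
      exact propext ⟨fun h => ⟨h.2.1, h.1, h.2.2⟩, fun h => ⟨h.2.1, h.1, h.2.2⟩⟩
    have hnonneg : ∀ i j, 0 ≤ t i j := by
      intro i j
      simp only [t]
      split_ifs with h
      · have := (hk _ _ (hmem i j h.1 h.2.1 h.2.2)).2.2.1
        omega
      · exact le_rfl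
    have hmono : ∀ i j, 1 ≤ j → i + 1 + j ≤ 2 * n + 1 → t i j ≤ t (i + 1) j := by
      intro i j hj hij
      rcases Nat.eq_zero_or_pos i with rfl | hi
      · refine le_trans (le_of_eq ?_) (hnonneg _ _)
        exact if_neg (by omega)
      · have m1 := hmem i j (by omega) (by omega) (by omega)
        have m2 := hmem (i + 1) j (by omega) (by omega) (by omega)
        have k1 := (hk _ _ m1).1
        have k2 := (hk _ _ m2).1
        simp only [t]
        rw [if_pos (by omega), if_pos (by omega)]
        refine sub_le_sub_left (le_of_half_cast_le ?_) _
        rw [← k1, ← k2]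
        rcases Nat.lt_or_ge i j with hlt | hge
        · have h := (hz.1.interlacing _ _ m1 (by omega)).1
          rw [show 2 * n - (max i j - min i j) + 1 = 2 * n - (max (i + 1) j - min (i + 1) j) by omega,
            show min i j + 1 = min (i + 1) j by omega] at h
          exact h
        · have h := (hz.1.interlacing _ _ m2 (by omega)).2
          rw [show 2 * n - (max (i + 1) j - min (i + 1) j) + 1 = 2 * n - (max i j - min i j) by omega,
            show min (i + 1) j = min i j by omega] at h
          rw [show min (i + 1) j = min i j by omega]
          exact h
    have ht : IsOutputArray n m t := by
      refine ⟨⟨fun i j h => if_neg h, hnonneg, hmono, ?_⟩, hsymm, ?_, ?_⟩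
      · intro i j hi hij
        rw [hsymm i j, hsymm i (j + 1)]
        exact hmono j i hi (by omega)
      · intro i j hij
        simp only [t]
        split_ifs with h
        · exact (hk _ _ (hmem i j h.1 h.2.1 h.2.2)).2.2.2 (by omega)
        · exact Even.zero
      · intro i j
        simp only [t]
        split_ifs with h
        · have := (hk _ _ (hmem i j h.1 h.2.1 h.2.2)).2.1
          omega
        · omega
    refine ⟨t, ht, ?_⟩
    funext i j
    by_cases h : (i, j) ∈ halfTriangle n
    · have h1 := mem_halfTriangle.1 h
      rw [patternOfArray_of_mem h, (hk i j h).1]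
      simp only [t]
      rw [if_pos (by omega), show min j (j + (2 * n - i)) = j by omega,
        show 2 * n - (max j (j + (2 * n - i)) - j) = i by omega, sub_sub_cancel]
    · rw [patternOfArray, if_neg h, hz.1.support i j h]

/-! ### The exponents of a pattern in terms of the weights -/

theorem diagSum_eq_sum (t : ℕ → ℕ → ℤ) (a d : ℕ) :
    diagSum t a (a + d) = ∑ j ∈ Finset.Icc 1 a, t j (j + d) := by
  induction a with
  | zero => rfl
  | succ a ih =>
    rw [Finset.sum_Icc_succ_top (by omega), ← ih, show a + 1 + d = a + d + 1 by omega, diagSum_succ]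
    ring

theorem altDiagSum_eq_sum (t : ℕ → ℕ → ℤ) (a : ℕ) :
    altDiagSum t a = ∑ i ∈ Finset.Icc 1 a, (-1) ^ (a - i) * t i i := by
  induction a with
  | zero => rfl
  | succ a ih =>
    rw [Finset.sum_Icc_succ_top (by omega), altDiagSum, ih, Nat.sub_self, pow_zero, one_mul,
      sub_eq_neg_add, ← Finset.sum_neg_distrib]
    congr 1
    refine Finset.sum_congr rfl fun i hi => ?_
    have := (Finset.mem_Icc.1 hi).2
    rw [show a + 1 - i = a - i + 1 by omega, pow_succ]
    ring

theorem rowSum_patternOfArray (n m : ℕ) (t : ℕ → ℕ → ℤ) {r : ℕ} (hr : r ≤ 2 * n) :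
    rowSum (patternOfArray n m t) r = (((r + 1) / 2 : ℕ) : ℝ) * ((m : ℝ) / 2) -
      (diagSum t ((r + 1) / 2) ((r + 1) / 2 + (2 * n - r)) : ℝ) / 2 := by
  rw [rowSum, diagSum_eq_sum]
  rw [Finset.sum_congr rfl fun j hj => patternOfArray_of_mem (n := n) (m := m) (t := t) (i := r)
    (j := j) (by rw [mem_halfTriangle]; have := Finset.mem_Icc.1 hj; omega)]
  push_cast
  rw [← Finset.sum_div, Finset.sum_sub_distrib]
  simp only [Finset.sum_const, Nat.card_Icc, Nat.add_sub_cancel, nsmul_eq_mul]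
  ring

/-- The exponent of `p_i` in the weight of a configuration. -/
def siteExponent (n : ℕ) (G : ℕ → ℕ → ℕ) (i : ℕ) : ℕ :=
  ∑ j ∈ Finset.Icc 1 (2 * n + 1 - i), G i j + ∑ j ∈ Finset.Icc 1 (i - 1), G j (2 * n + 1 - i)

theorem patternType_outputArray (n m : ℕ) (f : fundamentalSites n → ℕ) {i : ℕ} (hi : 1 ≤ i)
    (hin : i ≤ n) :
    patternType (patternOfArray n m (outputArray n f)) (2 * i) -
      patternType (patternOfArray n m (outputArray n f)) (2 * i - 1) =
        (siteExponent n (symmExtend n f) i : ℝ) + -((m : ℝ) / 2) := by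
  obtain ⟨i, rfl⟩ := Nat.exists_eq_add_of_le' hi
  obtain ⟨k, hk⟩ : ∃ k, k + i + 1 = 2 * n := ⟨2 * n - i - 1, by omega⟩
  have hd := fun a b h => diagSum_rsk (doubledBelow_nonneg (2 * n + 1) (symmExtend n f))
    (2 * n + 1) (a := a) (b := b) h
  unfold patternType
  rw [show 2 * (i + 1) - 1 = 2 * i + 1 by omega, show 2 * i + 1 - 1 = 2 * i by omega,
    rowSum_patternOfArray _ _ _ (by omega), rowSum_patternOfArray _ _ _ (by omega),
    rowSum_patternOfArray _ _ _ (by omega),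
    show (2 * (i + 1) + 1) / 2 = i + 1 by omega, show (2 * i + 1 + 1) / 2 = i + 1 by omega,
    show (2 * i + 1) / 2 = i by omega,
    show i + 1 + (2 * n - 2 * (i + 1)) = k by omega,
    show i + 1 + (2 * n - (2 * i + 1)) = k + 1 by omega,
    show i + (2 * n - 2 * i) = k + 1 by omega]
  unfold outputArray
  rw [hd _ _ (by omega), hd _ _ (by omega), hd _ _ (by omega)]
  set w := doubledBelow (2 * n + 1) (symmExtend n f) with hw
  have key : 2 * (∑ a ∈ Finset.Icc 1 (i + 1), ∑ b ∈ Finset.Icc 1 (k + 1), w a b) -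
      (∑ a ∈ Finset.Icc 1 (i + 1), ∑ b ∈ Finset.Icc 1 (k), w a b) -
      (∑ a ∈ Finset.Icc 1 i, ∑ b ∈ Finset.Icc 1 (k + 1), w a b) =
      2 * (siteExponent n (symmExtend n f) (i + 1) : ℤ) := by
    have e1 : ∑ b ∈ Finset.Icc 1 (k), w (i + 1) b =
        2 * ∑ b ∈ Finset.Icc 1 (k), (symmExtend n f (i + 1) b : ℤ) := by
      rw [Finset.mul_sum]
      refine Finset.sum_congr rfl fun b hb => ?_
      have := Finset.mem_Icc.1 hb
      exact if_neg (by omega)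
    have e2 : ∑ a ∈ Finset.Icc 1 i, w a (k + 1) =
        2 * ∑ a ∈ Finset.Icc 1 i, (symmExtend n f a (k + 1) : ℤ) := by
      rw [Finset.mul_sum]
      refine Finset.sum_congr rfl fun b hb => ?_
      have := Finset.mem_Icc.1 hb
      exact if_neg (by omega)
    have e3 : w (i + 1) (k + 1) = symmExtend n f (i + 1) (k + 1) :=
      if_pos (by omega)
    unfold siteExponent
    rw [show 2 * n + 1 - (i + 1) = k + 1 by omega]
    push_cast
    simp only [Finset.sum_Icc_succ_top (Nat.le_add_left 1 _), Finset.sum_add_distrib,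
      e1, e2, e3]
    ring
  have key' := congrArg (Int.cast : ℤ → ℝ) key
  push_cast at key' ⊢
  linarith

theorem sum_alternating_outputArray (n m : ℕ) (f : fundamentalSites n → ℕ) :
    ∑ i ∈ Finset.Icc 1 n,
      (-1 : ℝ) ^ (n - i) * ((m : ℝ) / 2 - patternOfArray n m (outputArray n f) (2 * n) i) =
        ((∑ i ∈ Finset.Icc 1 n, symmExtend n f i i : ℕ) : ℝ) := by
  have h := altDiagSum_rsk (doubledBelow_nonneg (2 * n + 1) (symmExtend n f))
    (doubledBelow_symmExtend_comm n f) (2 * n + 1)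
  rw [show (2 * n + 1) / 2 = n by omega, altDiagSum_eq_sum] at h
  have e : ∑ i ∈ Finset.Icc 1 n, doubledBelow (2 * n + 1) (symmExtend n f) i i =
      2 * ∑ i ∈ Finset.Icc 1 n, (symmExtend n f i i : ℤ) := by
    rw [Finset.mul_sum]
    exact Finset.sum_congr rfl fun i _ => if_neg (by omega)
  rw [e] at h
  have h' := congrArg (Int.cast : ℤ → ℝ) h
  push_cast at h' ⊢
  have e2 : ∑ i ∈ Finset.Icc 1 n, (-1 : ℝ) ^ (n - i) *
      ((m : ℝ) / 2 - patternOfArray n m (outputArray n f) (2 * n) i) =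
      (∑ i ∈ Finset.Icc 1 n, (-1 : ℝ) ^ (n - i) * (outputArray n f i i : ℝ)) / 2 := by
    rw [Finset.sum_div]
    refine Finset.sum_congr rfl fun i hi => ?_
    have := Finset.mem_Icc.1 hi
    rw [patternOfArray_of_mem (by rw [mem_halfTriangle]; omega)]
    push_cast
    rw [Nat.sub_self, Nat.add_zero]
    ring
  rw [e2]
  unfold outputArray
  rw [h']
  ring

theorem outputArray_antidiagonal_odd_iff (n : ℕ) (f : fundamentalSites n → ℕ) {i : ℕ} (hi : 1 ≤ i)
    (hin : i ≤ n) :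
    Odd (outputArray n f i (2 * n + 1 - i)) ↔ Odd (symmExtend n f i (2 * n + 1 - i)) := by
  obtain ⟨i, rfl⟩ := Nat.exists_eq_add_of_le' hi
  rw [outputArray, show 2 * n + 1 - (i + 1) = 2 * n - i - 1 + 1 by omega,
    rsk_doubledBelow (by omega), Int.odd_iff, Nat.odd_iff]
  omega

theorem isAtypical_iff {n m : ℕ} (hn : 1 ≤ n) {t : ℕ → ℕ → ℤ} (ht : IsOutputArray n m t) {i j : ℕ}
    (hij : (i, j) ∈ halfTriangle n) :
    IsAtypical n (patternOfArray n m t) i j ↔ Odd (t j (j + (2 * n - i))) := by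
  have hb : (2 * n, 1) ∈ halfTriangle n := by rw [mem_halfTriangle]; omega
  have h1 := ht.le j (j + (2 * n - i))
  have h2 := ht.le 1 (1 + (2 * n - 2 * n))
  have h3 := ht.even 1 (1 + (2 * n - 2 * n)) (by omega)
  rw [IsAtypical, patternOfArray_of_mem hij, patternOfArray_of_mem hb]
  simp only [isNonnegInt_half_iff, isNonnegHalfInt_half_iff]
  rw [Int.even_iff] at *
  simp only [Int.odd_iff, Int.even_iff]
  omega

theorem pow_atypicalCount {n m : ℕ} (hn : 1 ≤ n) {f : fundamentalSites n → ℕ}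
    (ht : IsOutputArray n m (outputArray n f)) (β : ℝ) :
    β ^ atypicalCount n (patternOfArray n m (outputArray n f)) =
      ∏ i ∈ Finset.Icc 1 n, β ^ (symmExtend n f i (2 * n + 1 - i) % 2) := by
  classical
  rw [Finset.prod_pow_eq_pow_sum]
  congr 1
  have e : ∀ k : ℕ, k % 2 = if Odd k then 1 else 0 := by
    intro k
    split_ifs with h
    · exact Nat.odd_iff.1 h
    · rw [Nat.not_odd_iff] at h
      exact h
  simp only [e]
  rw [← Finset.card_filter, atypicalCount]
  refine Finset.card_nbij' (fun q => q.2) (fun j => (2 * j - 1, j)) ?_ ?_ ?_ ?_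
  · rintro ⟨i, j⟩ h
    simp only [Finset.coe_filter, Set.mem_ofPred_eq] at h
    have h1 := mem_halfTriangle.1 h.1
    have h2 := (isAtypical_iff hn ht h.1).1 h.2
    have h3 : ¬ (j + (j + (2 * n - i)) ≤ 2 * n) := fun hle =>
      Int.not_even_iff_odd.2 h2 (ht.even _ _ hle)
    simp only [Finset.coe_filter, Set.mem_ofPred_eq, Finset.mem_Icc]
    refine ⟨by omega, ?_⟩
    rw [← outputArray_antidiagonal_odd_iff n f h1.1 (by omega),
      show 2 * n + 1 - j = j + (2 * n - i) by omega]
    exact h2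
  · intro j h
    simp only [Finset.coe_filter, Set.mem_ofPred_eq, Finset.mem_Icc] at h
    have h1 : (2 * j - 1, j) ∈ halfTriangle n := by rw [mem_halfTriangle]; omega
    simp only [Finset.coe_filter, Set.mem_ofPred_eq]
    refine ⟨h1, ?_⟩
    rw [isAtypical_iff hn ht h1, show j + (2 * n - (2 * j - 1)) = 2 * n + 1 - j by omega,
      outputArray_antidiagonal_odd_iff n f h.1.1 h.1.2]
    exact h.2
  · rintro ⟨i, j⟩ h
    simp only [Finset.coe_filter, Set.mem_ofPred_eq] at h
    have h1 := mem_halfTriangle.1 h.1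
    have h2 := (isAtypical_iff hn ht h.1).1 h.2
    have h3 : ¬ (j + (j + (2 * n - i)) ≤ 2 * n) := fun hle =>
      Int.not_even_iff_odd.2 h2 (ht.even _ _ hle)
    simp only [Prod.mk.injEq, and_true]
    omega
  · intro j _
    rfl

/-! ### The weight of a configuration -/

@[to_additive]
theorem prod_Icc_reflect {M : Type*} [CommMonoid M] {i n : ℕ} (h : i ≤ n) (g : ℕ → M) :
    ∏ j ∈ Finset.Icc i (2 * n + 1 - i), g j =
      g i * g (2 * n + 1 - i) * ∏ j ∈ Finset.Ioc i n, g j * g (2 * n + 1 - j) := by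
  have h1 : Finset.Icc i (2 * n + 1 - i) = Finset.Icc i n ∪ Finset.Icc (n + 1) (2 * n + 1 - i) := by
    ext j
    simp only [Finset.mem_union, Finset.mem_Icc]
    omega
  have h2 : Disjoint (Finset.Icc i n) (Finset.Icc (n + 1) (2 * n + 1 - i)) := by
    rw [Finset.disjoint_left]
    intro j
    simp only [Finset.mem_Icc]
    omega
  have h3 : ∏ j ∈ Finset.Icc (n + 1) (2 * n + 1 - i), g j =
      ∏ j ∈ Finset.Icc i n, g (2 * n + 1 - j) := by
    refine Finset.prod_nbij' (fun j => 2 * n + 1 - j) (fun j => 2 * n + 1 - j) ?_ ?_ ?_ ?_ ?_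
    · intro j hj
      simp only [Finset.mem_Icc] at hj ⊢
      omega
    · intro j hj
      simp only [Finset.mem_Icc] at hj ⊢
      omega
    · intro j hj
      simp only [Finset.mem_Icc] at hj ⊢
      omega
    · intro j hj
      simp only [Finset.mem_Icc] at hj ⊢
      omega
    · intro j hj
      simp only [Finset.mem_Icc] at hj
      rw [show 2 * n + 1 - (2 * n + 1 - j) = j by omega]
  rw [h1, Finset.prod_union h2, h3, ← Finset.prod_mul_distrib, Finset.Icc_eq_cons_Ioc h,
    Finset.prod_cons]

theorem prod_fundamentalSites {M : Type*} [CommMonoid M] (n : ℕ) (g : ℕ → ℕ → M) :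
    ∏ q ∈ fundamentalSites n, g q.1 q.2 = ∏ i ∈ Finset.Icc 1 n,
      (g i i * g i (2 * n + 1 - i) * ∏ j ∈ Finset.Ioc i n, g i j * g i (2 * n + 1 - j)) := by
  rw [Finset.prod_finset_product _ (Finset.Icc 1 n) fun i => Finset.Icc i (2 * n + 1 - i)]
  · exact Finset.prod_congr rfl fun i hi => prod_Icc_reflect (Finset.mem_Icc.1 hi).2 _
  · rintro ⟨i, j⟩
    simp only [mem_fundamentalSites, Finset.mem_Icc]
    omega

theorem prod_mul_pow_Ioc {M : Type*} [CommMonoid M] (n : ℕ) (x : ℕ → M) (a : ℕ → ℕ → ℕ) :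
    ∏ i ∈ Finset.Icc 1 n, ∏ j ∈ Finset.Ioc i n, (x i * x j) ^ a i j =
      ∏ i ∈ Finset.Icc 1 n,
        x i ^ (∑ j ∈ Finset.Ioc i n, a i j + ∑ j ∈ Finset.Icc 1 (i - 1), a j i) := by
  simp only [mul_pow, Finset.prod_mul_distrib, pow_add, ← Finset.prod_pow_eq_pow_sum]
  congr 1
  refine Finset.prod_comm' fun i j => ?_
  simp only [Finset.mem_Icc, Finset.mem_Ioc]
  omega

theorem siteExponent_eq {n : ℕ} {G : ℕ → ℕ → ℕ} (hG : ∀ i j, G i j = G j i) {i : ℕ} (hi : 1 ≤ i)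
    (hin : i ≤ n) : siteExponent n G i = G i i + G i (2 * n + 1 - i) +
      (∑ j ∈ Finset.Ioc i n, (G i j + G i (2 * n + 1 - j)) +
        ∑ j ∈ Finset.Icc 1 (i - 1), (G j i + G j (2 * n + 1 - i))) := by
  have h1 : Finset.Icc 1 (2 * n + 1 - i) =
      Finset.Icc 1 (i - 1) ∪ Finset.Icc i (2 * n + 1 - i) := by
    ext j
    simp only [Finset.mem_union, Finset.mem_Icc]
    omega
  have h2 : Disjoint (Finset.Icc 1 (i - 1)) (Finset.Icc i (2 * n + 1 - i)) := by
    rw [Finset.disjoint_left]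
    intro j
    simp only [Finset.mem_Icc]
    omega
  rw [siteExponent, h1, Finset.sum_union h2, sum_Icc_reflect hin,
    Finset.sum_add_distrib (s := Finset.Icc 1 (i - 1)), Finset.sum_congr rfl fun j _ => hG i j]
  ring

theorem normalization_eq (n : ℕ) (p : ℕ → ℝ) (α β : ℝ) :
    normalization n p α β = ∏ i ∈ Finset.Icc 1 n,
      ((1 + β * p i) / (1 - p i ^ 2) * (1 / (1 - α * p i)) *
        ∏ j ∈ Finset.Ioc i n, 1 / (1 - p i * p j) ^ 2) := by
  rw [normalization, mul_comm, Finset.prod_finset_product (β := ℝ) _ (Finset.Icc 1 n)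
    fun i => Finset.Ioc i n, ← Finset.prod_mul_distrib]
  rintro ⟨i, j⟩
  simp only [Finset.mem_filter, Finset.mem_product, Finset.mem_Icc, Finset.mem_Ioc]
  omega

theorem normalization_mul_prod_weightProb (n : ℕ) (p : ℕ → ℝ) (α β : ℝ)
    (hp : ∀ i ∈ Finset.Icc 1 n, 0 < p i ∧ p i < 1)
    (hp_symm : ∀ i ∈ Finset.Icc 1 n, p (2 * n + 1 - i) = p i)
    (hαp : ∀ i ∈ Finset.Icc 1 n, α * p i < 1) (hβ : 0 ≤ β) (G : ℕ → ℕ → ℕ)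
    (hG : ∀ i j, G i j = G j i) :
    normalization n p α β * ∏ q ∈ fundamentalSites n, weightProb n p α β q.1 q.2 (G q.1 q.2) =
      α ^ (∑ i ∈ Finset.Icc 1 n, G i i) *
        ((∏ i ∈ Finset.Icc 1 n, β ^ (G i (2 * n + 1 - i) % 2)) *
          ∏ i ∈ Finset.Icc 1 n, p i ^ siteExponent n G i) := by
  rw [normalization_eq, prod_fundamentalSites n fun i j => weightProb n p α β i j (G i j),
    ← Finset.prod_mul_distrib]
  have h1 : ∀ i ∈ Finset.Icc 1 n, ((1 + β * p i) / (1 - p i ^ 2) * (1 / (1 - α * p i)) *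
        ∏ j ∈ Finset.Ioc i n, 1 / (1 - p i * p j) ^ 2) *
      (weightProb n p α β i i (G i i) *
          weightProb n p α β i (2 * n + 1 - i) (G i (2 * n + 1 - i)) *
        ∏ j ∈ Finset.Ioc i n, weightProb n p α β i j (G i j) *
          weightProb n p α β i (2 * n + 1 - j) (G i (2 * n + 1 - j))) =
      α ^ G i i * (β ^ (G i (2 * n + 1 - i) % 2) * (p i ^ (G i i + G i (2 * n + 1 - i)) *
        ∏ j ∈ Finset.Ioc i n, (p i * p j) ^ (G i j + G i (2 * n + 1 - j)))) := by
    intro i hi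
    have hi' := Finset.mem_Icc.1 hi
    have hpi := hp i hi
    have n1 : 1 + β * p i ≠ 0 := by
      have := mul_nonneg hβ hpi.1.le
      positivity
    have n2 : 1 - p i ^ 2 ≠ 0 := by nlinarith
    have n3 : 1 - p i * α ≠ 0 := by
      have := hαp i hi
      linarith
    have hoff : (∏ j ∈ Finset.Ioc i n, 1 / (1 - p i * p j) ^ 2) *
        ∏ j ∈ Finset.Ioc i n, weightProb n p α β i j (G i j) *
          weightProb n p α β i (2 * n + 1 - j) (G i (2 * n + 1 - j)) =
        ∏ j ∈ Finset.Ioc i n, (p i * p j) ^ (G i j + G i (2 * n + 1 - j)) := by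
      rw [← Finset.prod_mul_distrib]
      refine Finset.prod_congr rfl fun j hj => ?_
      have hj' := Finset.mem_Ioc.1 hj
      have hjm : j ∈ Finset.Icc 1 n := Finset.mem_Icc.2 ⟨by omega, hj'.2⟩
      have hpj := hp j hjm
      have n4 : 1 - p i * p j ≠ 0 := by nlinarith
      unfold weightProb
      rw [if_neg (by omega), if_neg (by omega), if_neg (by omega), if_neg (by omega),
        hp_symm j hjm, pow_add]
      field_simp
    have hdiag : weightProb n p α β i i (G i i) = (1 - α * p i) * (α * p i) ^ G i i := if_pos rfl
    have hanti : weightProb n p α β i (2 * n + 1 - i) (G i (2 * n + 1 - i)) =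
        (1 - p i ^ 2) / (1 + β * p i) * β ^ (G i (2 * n + 1 - i) % 2) *
          p i ^ G i (2 * n + 1 - i) := by
      unfold weightProb
      rw [if_neg (by omega), if_pos (by omega), hp_symm i hi]
    rw [hdiag, hanti, ← hoff, mul_pow, pow_add]
    field_simp
  rw [Finset.prod_congr rfl h1, Finset.prod_mul_distrib, Finset.prod_mul_distrib,
    Finset.prod_pow_eq_pow_sum, Finset.prod_mul_distrib (f := fun i => p i ^ _),
    prod_mul_pow_Ioc n p fun i j => G i j + G i (2 * n + 1 - j), ← Finset.prod_mul_distrib]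
  congr 2
  refine Finset.prod_congr rfl fun i hi => ?_
  have hi' := Finset.mem_Icc.1 hi
  rw [siteExponent_eq hG hi'.1 hi'.2, ← pow_add]

/-! ### The distribution of the last passage time -/

theorem symmExtend_restrict {n : ℕ} {W : ℕ → ℕ → ℕ}
    (hW : ∀ i j, 1 ≤ i → i ≤ 2 * n → 1 ≤ j → j ≤ 2 * n → W i j = W j i) {i j : ℕ} (hi : 1 ≤ i)
    (hj : 1 ≤ j) (hij : i + j ≤ 2 * n + 1) :
    symmExtend n (fun q => W q.1.1 q.1.2) i j = W i j := by
  have hm : (min i j, max i j) ∈ fundamentalSites n := by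
    rw [mem_fundamentalSites]
    omega
  unfold symmExtend
  rw [dif_pos hm]
  change W (min i j) (max i j) = W i j
  rcases le_total i j with h | h
  · rw [min_eq_left h, max_eq_right h]
  · rw [min_eq_right h, max_eq_left h]
    exact hW j i hj (by omega) hi (by omega)

theorem IsStaircase.le_of_layer_le {s : ℕ} {t : ℕ → ℕ → ℤ} (ht : IsStaircase s t) {m : ℕ}
    (h : ∀ i j, 1 ≤ i → 1 ≤ j → i + j = s → t i j ≤ m) (i j : ℕ) : t i j ≤ m := by
  by_cases hij : 1 ≤ i ∧ 1 ≤ j ∧ i + j ≤ s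
  · obtain ⟨d, hd⟩ := Nat.exists_eq_add_of_le hij.2.2
    induction d generalizing i with
    | zero => exact h i j hij.1 hij.2.1 hd.symm
    | succ d ih =>
      exact (ht.mono_left i j hij.2.1 (by omega)).trans (ih (i + 1) (by omega) (by omega))
  · rw [ht.support i j hij]
    omega

theorem lastPassageTime_le_iff {n : ℕ} (hn : 1 ≤ n) {W : ℕ → ℕ → ℕ}
    (hW : ∀ i j, 1 ≤ i → i ≤ 2 * n → 1 ≤ j → j ≤ 2 * n → W i j = W j i)
    (hW' : ∀ i j, 1 ≤ i → i ≤ 2 * n → 1 ≤ j → j ≤ 2 * n →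
      W i j = W (2 * n + 1 - j) (2 * n + 1 - i)) (m : ℕ) :
    lastPassageTime W (2 * n) (2 * n) ≤ m ↔
      ∀ i j, outputArray n (fun q => W q.1.1 q.1.2) i j ≤ m := by
  rw [lastPassageTime_eq_lppRec W (by omega) (by omega), lppRec_le_iff (by omega) hW' m]
  have key : ∀ i j, i + 1 + (j + 1) = 2 * n + 1 →
      (outputArray n (fun q => W q.1.1 q.1.2) (i + 1) (j + 1) =
        (W (i + 1) (j + 1) + 2 * max (lppRec W i (j + 1)) (lppRec W (i + 1) j) : ℕ)) := by
    intro i j hij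
    have h := fun a b h1 h2 h3 => symmExtend_restrict (n := n) hW (i := a) (j := b) h1 h2 h3
    rw [outputArray, rsk_doubledBelow hij, h _ _ (by omega) (by omega) (by omega),
      lppRec_congr i (j + 1) fun a b h1 h2 h3 h4 => h a b h1 h3 (by omega),
      lppRec_congr (i + 1) j fun a b h1 h2 h3 h4 => h a b h1 h3 (by omega)]
    push_cast
    rfl
  constructor
  · intro h
    refine (isStaircase_rsk (doubledBelow_nonneg _ _) _).le_of_layer_le fun i j hi hj hij => ?_
    obtain ⟨i, rfl⟩ := Nat.exists_eq_add_of_le' hi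
    obtain ⟨j, rfl⟩ := Nat.exists_eq_add_of_le' hj
    have h1 := key i j hij
    rw [outputArray] at h1
    rw [h1]
    exact_mod_cast h i j hij
  · intro h i j hij
    have h1 := h (i + 1) (j + 1)
    rw [key i j hij] at h1
    exact_mod_cast h1

theorem finite_outputArray_le (n m : ℕ) : {f | ∀ i j, outputArray n f i j ≤ m}.Finite := by
  have hfin : (boundedPatterns n m).Finite := by
    have h : boundedPatterns n m ⊆
        ⋃ l ∈ boundedPartitions n ((m : ℝ) / 2), splitOrthogonalPatterns n l := by
      intro z hz
      simp only [Set.mem_iUnion]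
      exact ⟨z (2 * n), hz.2, hz.1, fun _ _ _ => rfl⟩
    exact ((boundedPartitions_finite n _).biUnion fun l _ =>
      splitOrthogonalPatterns_finite n l).subset h
  exact Set.Finite.of_finite_image (hfin.subset
    ((bijOn_patternOfArray n m).comp (bijOn_outputArray n m)).mapsTo.image_subset)
    ((bijOn_patternOfArray n m).comp (bijOn_outputArray n m)).injOn

theorem measure_lastPassageTime_le {Ω : Type*} [MeasurableSpace Ω] (μ : Measure Ω)
    [IsProbabilityMeasure μ] {n : ℕ} (hn : 1 ≤ n) (p : ℕ → ℝ) (α β : ℝ) (W : ℕ → ℕ → Ω → ℕ)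
    (hW : IsDoublySymmetricWeights μ n p α β W) (m : ℕ) :
    μ.real {ω | lastPassageTime (fun i j => W i j ω) (2 * n) (2 * n) ≤ m} =
      ∑ᶠ f ∈ {f | ∀ i j, outputArray n f i j ≤ m},
        ∏ q ∈ fundamentalSites n,
          weightProb n p α β q.1 q.2 (symmExtend n f q.1 q.2) := by
  have hmeas : ∀ q : fundamentalSites n, Measurable (W q.1.1 q.1.2) := by
    rintro ⟨⟨i, j⟩, hq⟩
    have h := mem_fundamentalSites.1 hq
    exact hW.measurable i (Finset.mem_Icc.2 (by omega)) j (Finset.mem_Icc.2 (by omega))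
  have hset : {ω | lastPassageTime (fun i j => W i j ω) (2 * n) (2 * n) ≤ m} =
      ⋃ f ∈ (finite_outputArray_le n m).toFinset,
        ⋂ q : fundamentalSites n, W q.1.1 q.1.2 ⁻¹' {f q} := by
    ext ω
    have h1 : ∀ i j, 1 ≤ i → i ≤ 2 * n → 1 ≤ j → j ≤ 2 * n → W i j ω = W j i ω :=
      fun i j a b c d =>
        hW.symm_diagonal i (Finset.mem_Icc.2 ⟨a, b⟩) j (Finset.mem_Icc.2 ⟨c, d⟩) ω
    have h2 : ∀ i j, 1 ≤ i → i ≤ 2 * n → 1 ≤ j → j ≤ 2 * n →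
        W i j ω = W (2 * n + 1 - j) (2 * n + 1 - i) ω :=
      fun i j a b c d =>
        hW.symm_antidiagonal i (Finset.mem_Icc.2 ⟨a, b⟩) j (Finset.mem_Icc.2 ⟨c, d⟩) ω
    rw [Set.mem_ofPred_eq, lastPassageTime_le_iff hn (W := fun i j => W i j ω) h1 h2 m]
    simp only [Set.mem_iUnion, Set.mem_iInter, Set.mem_preimage, Set.mem_singleton_iff,
      Set.Finite.mem_toFinset, Set.mem_ofPred_eq]
    constructor
    · intro h
      exact ⟨_, h, fun q => rfl⟩
    · rintro ⟨f, hf, h⟩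
      rw [show (fun q : fundamentalSites n => W q.1.1 q.1.2 ω) = f from funext h]
      exact hf
  have hms : ∀ f : fundamentalSites n → ℕ,
      MeasurableSet (⋂ q : fundamentalSites n, W q.1.1 q.1.2 ⁻¹' {f q}) := fun f =>
    MeasurableSet.iInter fun q => hmeas q (measurableSet_singleton _)
  rw [hset, finsum_mem_eq_finite_toFinset_sum _ (finite_outputArray_le n m),
    measureReal_biUnion_finset _ fun f _ => hms f]
  · refine Finset.sum_congr rfl fun f _ => ?_
    have h := hW.indep.meas_iInter (s := fun q => W q.1.1 q.1.2 ⁻¹' {f q})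
      fun q => ⟨{f q}, measurableSet_singleton _, rfl⟩
    rw [measureReal_def, h, ENNReal.toReal_prod, ← Finset.prod_coe_sort (fundamentalSites n)
      fun q => weightProb n p α β q.1 q.2 (symmExtend n f q.1 q.2)]
    refine Finset.prod_congr rfl fun q _ => ?_
    rw [symmExtend_apply]
    exact hW.law q.1.1 q.1.2 q.2 (f q)
  · intro f _ g _ hfg
    refine Set.disjoint_left.2 fun ω h1 h2 => hfg ?_
    simp only [Set.mem_iInter, Set.mem_preimage, Set.mem_singleton_iff] at h1 h2
    exact funext fun q => (h1 q).symm.trans (h2 q)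

/-! ### The bounded Littlewood sum -/

theorem transCB_bounded_sum (n m : ℕ) (x : ℕ → ℝ) (α β : ℝ) :
    ∑ᶠ l ∈ boundedPartitions n ((m : ℝ) / 2),
        α ^ (∑ i ∈ Finset.Icc 1 n, (-1 : ℝ) ^ (n - i) * ((m : ℝ) / 2 - l i)) * transCB n l x β =
      ∑ᶠ z ∈ boundedPatterns n m,
        α ^ (∑ i ∈ Finset.Icc 1 n, (-1 : ℝ) ^ (n - i) * ((m : ℝ) / 2 - z (2 * n) i)) *
          (β ^ atypicalCount n z *
            ∏ i ∈ Finset.Icc 1 n, x i ^ (patternType z (2 * i) - patternType z (2 * i - 1))) := by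
  have bottom : ∀ l ∈ boundedPartitions n ((m : ℝ) / 2), ∀ z ∈ splitOrthogonalPatterns n l,
      z (2 * n) = l := by
    intro l hl z hz
    funext j
    by_cases hj : 1 ≤ j ∧ j ≤ n
    · exact hz.2 j hj.1 hj.2
    · have h0 : l j = 0 := by
        rcases hl with ⟨⟨-, hl, -⟩ | ⟨-, hl, -⟩, -⟩ <;> exact hl.support j hj
      rw [h0]
      refine hz.1.support _ _ ?_
      rw [mem_halfTriangle]
      omega
  have hset : boundedPatterns n m =
      ⋃ l ∈ boundedPartitions n ((m : ℝ) / 2), splitOrthogonalPatterns n l := by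
    ext z
    simp only [Set.mem_iUnion]
    constructor
    · intro hz
      exact ⟨z (2 * n), hz.2, hz.1, fun _ _ _ => rfl⟩
    · rintro ⟨l, hl, hz⟩
      refine ⟨hz.1, ?_⟩
      rw [bottom l hl z hz]
      exact hl
  rw [hset, finsum_mem_biUnion _ (boundedPartitions_finite n _)
    fun l _ => splitOrthogonalPatterns_finite n l]
  · refine finsum_mem_congr rfl fun l hl => ?_
    rw [transCB, mul_finsum_mem]
    refine finsum_mem_congr rfl fun z hz => ?_
    rw [bottom l hl z hz]
  · intro l hl l' hl' hne
    refine Set.disjoint_left.2 fun z hz hz' => hne ?_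
    rw [← bottom l hl z hz, bottom l' hl' z hz']

end SymLPP

/-- For a doubly symmetric `2n × 2n` array of weights with parameters `p`, `α`, `β`, and for `u` in
`(1/2) ℤ_{≥0}`, the distribution function of the last passage time is a bounded Littlewood sum of
CB-interpolating Schur polynomials. -/
theorem mainTheorem3 {Ω : Type*} [MeasurableSpace Ω] (μ : MeasureTheory.Measure Ω)
    [MeasureTheory.IsProbabilityMeasure μ]
    (n : ℕ) (hn : 1 ≤ n) (p : ℕ → ℝ) (α β : ℝ)
    (hp : ∀ i ∈ Finset.Icc 1 n, 0 < p i ∧ p i < 1)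
    (hp_symm : ∀ i ∈ Finset.Icc 1 n, p (2 * n + 1 - i) = p i)
    (hα : 0 ≤ α) (hαp : ∀ i ∈ Finset.Icc 1 n, α * p i < 1) (hβ : 0 ≤ β)
    (W : ℕ → ℕ → Ω → ℕ) (hW : SymLPP.IsDoublySymmetricWeights μ n p α β W)
    (u : ℝ) (hu : ∃ m : ℕ, u = (m : ℝ) / 2) :
    SymLPP.normalization n p α β *
        μ.real {ω | (SymLPP.lastPassageTime (fun i j => W i j ω) (2 * n) (2 * n) : ℝ) ≤ 2 * u} =
      (∏ i ∈ Finset.Icc 1 n, p i) ^ u *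
        ∑ᶠ l ∈ SymLPP.boundedPartitions n u,
          α ^ (∑ i ∈ Finset.Icc 1 n, (-1 : ℝ) ^ (n - i) * (u - l i)) *
            SymLPP.transCB n l p β := by
  obtain ⟨m, rfl⟩ := hu
  have hset : {ω | (SymLPP.lastPassageTime (fun i j => W i j ω) (2 * n) (2 * n) : ℝ) ≤
      2 * ((m : ℝ) / 2)} =
      {ω | SymLPP.lastPassageTime (fun i j => W i j ω) (2 * n) (2 * n) ≤ m} := by
    ext ω
    simp only [Set.mem_ofPred_eq]
    rw [mul_div_cancel₀ _ (two_ne_zero), Nat.cast_le]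
  rw [hset, SymLPP.measure_lastPassageTime_le μ hn p α β W hW m, SymLPP.transCB_bounded_sum,
    mul_finsum_mem, mul_finsum_mem]
  refine finsum_mem_eq_of_bijOn _
    ((SymLPP.bijOn_patternOfArray n m).comp (SymLPP.bijOn_outputArray n m)) fun f hf => ?_
  have ht := (SymLPP.bijOn_outputArray n m).mapsTo hf
  rw [SymLPP.normalization_mul_prod_weightProb n p α β hp hp_symm hαp hβ _
    (SymLPP.symmExtend_comm n f)]
  simp only [Function.comp_apply]
  rw [SymLPP.sum_alternating_outputArray, Real.rpow_natCast, SymLPP.pow_atypicalCount hn ht]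
  have hprod : ∏ i ∈ Finset.Icc 1 n, p i ^
      (SymLPP.patternType (SymLPP.patternOfArray n m (SymLPP.outputArray n f)) (2 * i) -
        SymLPP.patternType (SymLPP.patternOfArray n m (SymLPP.outputArray n f)) (2 * i - 1)) =
      (∏ i ∈ Finset.Icc 1 n, p i ^ SymLPP.siteExponent n (SymLPP.symmExtend n f) i) *
        (∏ i ∈ Finset.Icc 1 n, p i) ^ (-((m : ℝ) / 2)) := by
    rw [← Real.finsetProd_rpow _ _ fun i hi => (hp i hi).1.le, ← Finset.prod_mul_distrib]
    refine Finset.prod_congr rfl fun i hi => ?_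
    have hi' := Finset.mem_Icc.1 hi
    rw [SymLPP.patternType_outputArray n m f hi'.1 hi'.2, Real.rpow_add (hp i hi).1,
      Real.rpow_natCast]
  have hpos : 0 < ∏ i ∈ Finset.Icc 1 n, p i := Finset.prod_pos fun i hi => (hp i hi).1
  rw [hprod, Real.rpow_neg hpos.le]
  have := (Real.rpow_pos_of_pos hpos ((m : ℝ) / 2)).ne'
  field_simp
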